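/- Let $p$ be a prime, $q$ a power of $p$, $A=\mathbb{F}_q[T]$, $K=\mathbb{F}_q(T)$, let $K_\infty$ be the completion of $K$ for the absolute value with $|a|=q^{\deg a}$ for nonzero $a\in A$, let $\mathbb{C}_\infty$ be the completion of an algebraic closure of $K_\infty$, $\Omega=\mathbb{C}_\infty\setminus K_\infty$ and $\Gamma=\mathrm{GL}_2(A)$, acting on $\Omega$ by $\gamma z=\frac{az+b}{cz+d}$ for $\gamma=\begin{bmatrix}a&b\\c&d\end{bmatrix}$. Fix a fundamental period $\widetilde\pi$ of the Carlitz module, i.e. a nonzero $\widetilde\pi\in\mathbb{C}_\infty$ such that $\widetilde\pi A$ is the set of zeros of $e_C(z)=\sum_{i\ge 0} z^{q^i}/\prod_{j<i}(T^{q^i}-T^{q^j})$. For $z\in\Omega$ put $u(z)=\widetilde\pi^{-1}\sum_{a\in A}\frac1{z+a}$. For $w\ge 1$ let $G_w$ be the $w$-th Goss polynomial of the lattice $\widetilde\pi A$: $G_1=X$ and, for $w\ge 2$, $G_w=X\sum_{i\ge 0,\,q^i<w}\alpha_i\,G_{w-q^i}$, where $\alpha_i$ is the coefficient of $X^{q^i}$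 in $X\prod_{0\ne\lambda\in\widetilde\pi A}(1-X/\lambda)$ (so that $G_w(u(z))=\widetilde\pi^{-w}\sum_{a\in A}(z+a)^{-w}$). Let $H\subset\Gamma$ be the subgroup of matrices with bottom row $(0,1)$ and, for integers $k\ge 0$ and $w\ge 1$, let $$P_{k,w}(z)=\sum_{\gamma\in H\backslash\Gamma}\frac{(\det\gamma)^m}{(cz+d)^k}\,G_w(u(\gamma z)),\qquad z\in\Omega,$$ where $m$ is the reduction of $w$ modulo $q-1$ and $(c,d)$ is the bottom row of $\gamma$. If $f:\Omega\to\mathbb{C}_\infty$ has at each $z\in\Omega$ an expansion $f(z+\varepsilon)=\sum_{r\ge 0}\mathcal{D}_r f(z)\,\varepsilon^r$ for all sufficiently small $\varepsilon$, define its $r$-th hyperderivative by $D_r f=\frac{(-1)^r}{\widetilde\pi^r}\,\mathcal{D}_r f$. Theorem. If $k$ and $n$ are positive integers such that $\binom{k+n-1}{j}\equiv 0 \pmod p$ for all $1\le j\le n$, then the series defining $P_{k,1}$ and $P_{k+2n,1+n}$ converge unconditionally at every point of $\Omega$, the function $P_{k,1}$ has such an expansion at every point of $\Omega$, and $$D_n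 P_{k,1}=P_{k+2n,\,1+n}\quad\text{on }\Omega .$$ -/

import Mathlib

open Polynomial Filter Topology
open scoped NNReal

noncomputable section

namespace Drinfeld

/-! ### The fields `K_∞` and `ℂ_∞` -/

section Fields

variable (F : Type*) [Field F] [Fintype F]

open scoped Classical in
/-- `K_∞`, the completion of `K = 𝔽_q(T)` at the place at infinity. -/
def KInf : Type _ := RatFunc.CompletionAtInfty F

namespace KInf

lemma one_lt_card : (1 : ℝ≥0) < (Fintype.card F : ℝ≥0) := by
  exact_mod_cast Fintype.one_lt_card

open scoped Classical in
/-- The real absolute value attached to the valuation at infinity, normalised by `|T| = q`. -/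
@[reducible]
def rankOne : Valuation.RankOne (Valued.v (R := RatFunc.CompletionAtInfty F)) where
  hom' := (WithZeroMulInt.toNNReal (one_lt_card F).ne_zero).comp
    MonoidWithZeroHom.ValueGroup₀.embedding
  strictMono' := (WithZeroMulInt.toNNReal_strictMono (one_lt_card F)).comp
    MonoidWithZeroHom.ValueGroup₀.embedding_strictMono
  exists_val_nontrivial := by
    refine ⟨algebraMap (RatFunc F) _ RatFunc.X, ?_⟩
    have h : Valued.v (algebraMap (RatFunc F) (RatFunc.CompletionAtInfty F) RatFunc.X)
        = RatFunc.inftyValuation F RatFunc.X :=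
      @Valued.extensionValuation_apply_coe _ _ _ _ (RatFunc.inftyValued F) RatFunc.X
    rw [h, RatFunc.inftyValuation.X]
    simp

open scoped Classical in
instance : NontriviallyNormedField (KInf F) :=
  letI := rankOne F
  Valued.toNontriviallyNormedField (RatFunc.CompletionAtInfty F) (WithZero (Multiplicative ℤ))

open scoped Classical in
instance : IsUltrametricDist (KInf F) :=
  letI := rankOne F
  letI := Valued.toNormedField (RatFunc.CompletionAtInfty F) (WithZero (Multiplicative ℤ))
  inferInstanceAs (IsUltrametricDist (RatFunc.CompletionAtInfty F))

open scoped Classical in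
instance : CompleteSpace (KInf F) :=
  letI := RatFunc.inftyValued F
  inferInstanceAs (CompleteSpace (UniformSpace.Completion (RatFunc F)))

open scoped Classical in
instance : Algebra (RatFunc F) (KInf F) :=
  inferInstanceAs (Algebra (RatFunc F) (RatFunc.CompletionAtInfty F))

end KInf

/-- An algebraic closure of `K_∞`, with the unique extension of the absolute value. -/
def KInfAlg : Type _ := AlgebraicClosure (KInf F)

namespace KInfAlg

instance : NontriviallyNormedField (KInfAlg F) :=
  spectralNorm.nontriviallyNormedField (KInf F) (AlgebraicClosure (KInf F))

instance : NormedAlgebra (KInf F) (KInfAlg F) :=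
  spectralNorm.normedAlgebra (KInf F) (AlgebraicClosure (KInf F))

instance : IsUltrametricDist (KInfAlg F) :=
  IsUltrametricDist.of_normedAlgebra (KInf F)

end KInfAlg

/-- `ℂ_∞`, the completion of the algebraic closure of `K_∞`. -/
def CInf : Type _ := UniformSpace.Completion (KInfAlg F)

namespace CInf

instance : NormedField (CInf F) :=
  inferInstanceAs (NormedField (UniformSpace.Completion (KInfAlg F)))

instance : NormedAlgebra (KInf F) (CInf F) :=
  inferInstanceAs (NormedAlgebra (KInf F) (UniformSpace.Completion (KInfAlg F)))

instance : IsUltrametricDist (CInf F) :=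
  IsUltrametricDist.of_normedAlgebra (KInf F)

instance : CompleteSpace (CInf F) :=
  inferInstanceAs (CompleteSpace (UniformSpace.Completion (KInfAlg F)))

instance : NontriviallyNormedField (CInf F) where
  non_trivial := by
    obtain ⟨x, hx⟩ := NontriviallyNormedField.non_trivial (α := KInf F)
    exact ⟨algebraMap (KInf F) (CInf F) x, by rwa [norm_algebraMap']⟩

end CInf

/-- The embedding of `A = 𝔽_q[T]` into `ℂ_∞`. -/
def ofA : F[X] →+* CInf F :=
  (algebraMap (KInf F) (CInf F)).comp
    ((algebraMap (RatFunc F) (KInf F)).comp (algebraMap F[X] (RatFunc F)))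

/-- The Drinfeld upper half-plane `Ω = ℂ_∞ ∖ K_∞`. -/
def Omega : Set (CInf F) := (Set.range (algebraMap (KInf F) (CInf F)))ᶜ

end Fields

variable {F : Type*} [Field F] [Fintype F]

/-! ### The Carlitz module and its period -/

/-- `D_i = ∏_{j < i} (T^{q^i} - T^{q^j})`. -/
def carlitzD (F : Type*) [Field F] [Fintype F] (i : ℕ) : F[X] :=
  ∏ j ∈ Finset.range i, (X ^ Fintype.card F ^ i - X ^ Fintype.card F ^ j)

/-- The exponential `e_C(z) = ∑ z^{q^i} / D_i` of the Carlitz module `C_T(X) = T X + X^q`. -/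
def carlitzExp (z : CInf F) : CInf F :=
  ∑' i : ℕ, z ^ Fintype.card F ^ i / ofA F (carlitzD F i)

/-- `ϖ` is a fundamental period of the Carlitz module: it generates the (rank one) kernel of
the Carlitz exponential as an `A`-module. -/
def IsCarlitzPeriod (ϖ : CInf F) : Prop :=
  ϖ ≠ 0 ∧ {z : CInf F | carlitzExp z = 0} = Set.range fun a : F[X] => ϖ * ofA F a

/-! ### Goss polynomials of the lattice `Λ = ϖ A` -/

/-- The coefficient of `X ^ j` in the lattice exponential `e_Λ(X) = X ∏_{λ ∈ Λ ∖ 0} (1 - X / λ)`,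
where `Λ = ϖ A`; the infinite product is the limit of the products over `deg a < d`. -/
def latticeExpCoeff (ϖ : CInf F) (j : ℕ) : CInf F :=
  limUnder atTop fun d : ℕ =>
    (X * ∏ᶠ a ∈ {a : F[X] | a ≠ 0 ∧ a.natDegree < d},
      (1 - C (ϖ * ofA F a)⁻¹ * X : (CInf F)[X])).coeff j

lemma card_pow_pos (F : Type*) [Field F] [Fintype F] (i : ℕ) : 0 < Fintype.card F ^ i :=
  Nat.pow_pos (Fintype.card_pos_iff.2 ⟨(0 : F)⟩)

/-- The Goss polynomials of `Λ = ϖ A`: `G_1 = X` and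
`G_n = X * (G_{n-1} + α_1 G_{n-q} + α_2 G_{n-q^2} + ⋯)`, the sum being over the `i` with
`q ^ i < n`, where `α_i` is the coefficient of `X ^ (q ^ i)` in `e_Λ`. -/
def gossPoly (ϖ : CInf F) : ℕ → (CInf F)[X]
  | 0 => 1
  | 1 => X
  | n + 2 => X * ∑ i ∈ Finset.range (n + 2),
      have _ := card_pow_pos F i
      if Fintype.card F ^ i < n + 2 then
        C (latticeExpCoeff ϖ (Fintype.card F ^ i)) * gossPoly ϖ (n + 2 - Fintype.card F ^ i)
      else 0
  decreasing_by omega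

/-- The uniformizer at infinity `u(z) = ϖ⁻¹ ∑_{a ∈ A} 1 / (z + a)`. -/
def unif (ϖ : CInf F) (z : Omega F) : CInf F :=
  ϖ⁻¹ * ∑' a : F[X], 1 / ((z : CInf F) + ofA F a)

/-! ### The action of `Γ = GL₂(A)` on `Ω` -/

/-- `Γ = GL₂(A)`. -/
abbrev Gam (F : Type*) [Field F] : Type _ := Matrix.GeneralLinearGroup (Fin 2) F[X]

/-- `j_γ(z) = c z + d`. -/
def jfac (γ : Gam F) (z : CInf F) : CInf F := ofA F (γ 1 0) * z + ofA F (γ 1 1)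

lemma ofA_injective : Function.Injective (ofA F) := by
  have h3 : Function.Injective (algebraMap F[X] (RatFunc F)) := IsFractionRing.injective _ _
  exact (algebraMap (KInf F) (CInf F)).injective.comp
    ((algebraMap (RatFunc F) (KInf F)).injective.comp h3)

/-- Elements of `Ω` are linearly independent of `1` over `A`. -/
lemma eq_zero_of_mul_add_eq_zero {z : CInf F} (hz : z ∈ Omega F) {x y : KInf F}
    (h : algebraMap (KInf F) (CInf F) x * z + algebraMap (KInf F) (CInf F) y = 0) :
    x = 0 ∧ y = 0 := by
  have hx : x = 0 := by
    by_contra hx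
    apply hz
    refine ⟨-y / x, ?_⟩
    have hx' : algebraMap (KInf F) (CInf F) x ≠ 0 := by simpa using hx
    rw [map_div₀, map_neg, div_eq_iff hx']
    linear_combination -h
  subst hx
  refine ⟨rfl, ?_⟩
  simpa using h

lemma det_ofA_ne_zero (γ : Gam F) :
    ofA F (γ 0 0) * ofA F (γ 1 1) - ofA F (γ 0 1) * ofA F (γ 1 0) ≠ 0 := by
  rw [← map_mul, ← map_mul, ← map_sub, ← Matrix.det_fin_two, Ne, map_eq_zero_iff _ ofA_injective]
  exact ((Matrix.isUnit_iff_isUnit_det _).1 γ.isUnit).ne_zero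

lemma jfac_ne_zero (γ : Gam F) {z : CInf F} (hz : z ∈ Omega F) : jfac γ z ≠ 0 := by
  intro h
  obtain ⟨hc, hd⟩ := eq_zero_of_mul_add_eq_zero hz
    (x := algebraMap (RatFunc F) (KInf F) (algebraMap F[X] (RatFunc F) (γ 1 0)))
    (y := algebraMap (RatFunc F) (KInf F) (algebraMap F[X] (RatFunc F) (γ 1 1))) h
  apply det_ofA_ne_zero γ
  have hc' : ofA F (γ 1 0) = 0 := by
    rw [ofA, RingHom.comp_apply, RingHom.comp_apply, hc, map_zero]
  have hd' : ofA F (γ 1 1) = 0 := by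
    rw [ofA, RingHom.comp_apply, RingHom.comp_apply, hd, map_zero]
  rw [hc', hd']
  ring

lemma moebius_mem (γ : Gam F) {z : CInf F} (hz : z ∈ Omega F) :
    (ofA F (γ 0 0) * z + ofA F (γ 0 1)) / jfac γ z ∈ Omega F := by
  rintro ⟨κ, hκ⟩
  rw [eq_div_iff (jfac_ne_zero γ hz)] at hκ
  set ι : F[X] →+* KInf F := (algebraMap (RatFunc F) (KInf F)).comp (algebraMap F[X] (RatFunc F))
  have hι : ∀ a, ofA F a = algebraMap (KInf F) (CInf F) (ι a) := fun _ => rfl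
  obtain ⟨h1, h2⟩ := eq_zero_of_mul_add_eq_zero hz
    (x := ι (γ 0 0) - κ * ι (γ 1 0)) (y := ι (γ 0 1) - κ * ι (γ 1 1)) (by
      simp only [map_sub, map_mul, ← hι]
      rw [jfac] at hκ
      linear_combination -hκ)
  apply det_ofA_ne_zero γ
  simp only [hι, ← map_mul, ← map_sub (algebraMap (KInf F) (CInf F))]
  rw [map_eq_zero, map_mul, map_mul]
  linear_combination ι (γ 1 1) * h1 - ι (γ 1 0) * h2

/-- `γ z = (a z + b) / (c z + d)`. -/
def moebius (γ : Gam F) (z : Omega F) : Omega F :=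
  ⟨(ofA F (γ 0 0) * z + ofA F (γ 0 1)) / jfac γ z, moebius_mem γ z.2⟩

/-- The slash operator of weight `k` and type `m`. -/
def slash (k m : ℕ) (f : Omega F → CInf F) (γ : Gam F) (z : Omega F) : CInf F :=
  ofA F (γ : Matrix (Fin 2) (Fin 2) F[X]).det ^ m / jfac γ z ^ k * f (moebius γ z)

/-- The subgroup `H` of matrices with bottom row `(0, 1)`. -/
def subH (F : Type*) [Field F] : Subgroup (Gam F) where
  carrier := {γ | γ 1 0 = 0 ∧ γ 1 1 = 1}
  one_mem' := by simp
  mul_mem' := by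
    rintro γ δ ⟨h1, h2⟩ ⟨h3, h4⟩
    simp [Matrix.mul_apply, Fin.sum_univ_two, h1, h2, h3, h4]
  inv_mem' := by
    rintro γ ⟨h1, h2⟩
    have h : ∀ j, (γ * γ⁻¹) 1 j = γ⁻¹ 1 j := fun j => by
      rw [Matrix.GeneralLinearGroup.coe_mul, Matrix.mul_apply, Fin.sum_univ_two, h1, h2]
      ring
    rw [mul_inv_cancel] at h
    exact ⟨by simpa using (h 0).symm, by simpa using (h 1).symm⟩

/-! ### Poincaré series -/

lemma gossPoly_eval_mul (ϖ : CInf F) (e : F) (n : ℕ) (t : CInf F) :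
    (gossPoly ϖ n).eval (ofA F (C e) * t) = ofA F (C e) ^ n * (gossPoly ϖ n).eval t := by
  induction n using Nat.strong_induction_on with
  | _ n ih =>
    match n with
    | 0 => simp [gossPoly]
    | 1 => simp [gossPoly]
    | n + 2 =>
      simp only [gossPoly, eval_mul, eval_X]
      rw [eval_finsetSum, eval_finsetSum, Finset.mul_sum, Finset.mul_sum, Finset.mul_sum]
      refine Finset.sum_congr rfl fun i _ => ?_
      split_ifs with h
      · have hpos := card_pow_pos F i
        have hq : ofA F (C e) ^ Fintype.card F ^ i = ofA F (C e) := by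
          rw [← map_pow, ← C_pow, FiniteField.pow_card_pow]
        have hpow : ofA F (C e) ^ (n + 2)
            = ofA F (C e) * ofA F (C e) ^ (n + 2 - Fintype.card F ^ i) := by
          nth_rewrite 2 [← hq]
          rw [← pow_add]
          congr 1
          omega
        rw [eval_mul, eval_mul, ih _ (by omega), hpow, eval_C, eval_C]
        ring
      · simp

/-- The translation and scaling behaviour `u(e z + b) = e⁻¹ u(z)` for `e ∈ 𝔽_q^×`, `b ∈ A`. -/
lemma unif_affine (ϖ : CInf F) {e : F} (he : e ≠ 0) (b : F[X]) {z w : Omega F}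
    (h : (w : CInf F) = ofA F (C e) * z + ofA F b) :
    unif ϖ w = ofA F (C e⁻¹) * unif ϖ z := by
  have hE : ofA F (C e) * ofA F (C e⁻¹) = 1 := by
    rw [← map_mul, ← C_mul, mul_inv_cancel₀ he, C_1, map_one]
  let φ : F[X] ≃ F[X] :=
    { toFun := fun a => C e * a - b
      invFun := fun a => C e⁻¹ * (a + b)
      left_inv := fun a => by
        simp [← mul_assoc, ← C_mul, inv_mul_cancel₀ he]
      right_inv := fun a => by
        simp [← mul_assoc, ← C_mul, mul_inv_cancel₀ he] }
  have key : ∑' a : F[X], 1 / ((w : CInf F) + ofA F a)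
      = ofA F (C e⁻¹) * ∑' a : F[X], 1 / ((z : CInf F) + ofA F a) := by
    rw [← φ.tsum_eq, ← tsum_mul_left]
    refine tsum_congr fun a => ?_
    have h1 : (w : CInf F) + ofA F (φ a) = ofA F (C e) * (z + ofA F a) := by
      simp only [φ, Equiv.coe_fn_mk, map_sub, map_mul, h]
      ring
    rw [h1, one_div, mul_inv, ← eq_inv_of_mul_eq_one_right hE, one_div]
  rw [unif, unif, key]
  ring

lemma slash_goss_mul (ϖ : CInf F) (k n : ℕ) (z : Omega F) {h : Gam F} (hh : h ∈ subH F)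
    (γ : Gam F) :
    slash k (n % (Fintype.card F - 1)) (fun w => (gossPoly ϖ n).eval (unif ϖ w)) (h * γ) z
      = slash k (n % (Fintype.card F - 1)) (fun w => (gossPoly ϖ n).eval (unif ϖ w)) γ z := by
  obtain ⟨h0, h1⟩ := hh
  have hdet : IsUnit (h 0 0) := by
    have := (Matrix.isUnit_iff_isUnit_det _).1 h.isUnit
    rwa [Matrix.det_fin_two, h0, h1, mul_one, mul_zero, sub_zero] at this
  obtain ⟨e, he, hC⟩ := Polynomial.isUnit_iff.1 hdet
  have he0 : e ≠ 0 := he.ne_zero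
  have hj : jfac (h * γ) z = jfac γ z := by
    simp [jfac, Matrix.mul_apply, Fin.sum_univ_two, h0, h1]
  have hjz := jfac_ne_zero γ z.2
  have hm : ((moebius (h * γ) z : Omega F) : CInf F)
      = ofA F (C e) * (moebius γ z : Omega F) + ofA F (h 0 1) := by
    simp only [moebius, hj]
    rw [div_eq_iff hjz, add_mul, mul_assoc, div_mul_cancel₀ _ hjz]
    simp only [jfac, Matrix.GeneralLinearGroup.coe_mul, Matrix.mul_apply, Fin.sum_univ_two, ← hC,
      map_add, map_mul]
    ring
  have hd : ((h * γ : Gam F) : Matrix (Fin 2) (Fin 2) F[X]).det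
      = C e * (γ : Matrix (Fin 2) (Fin 2) F[X]).det := by
    rw [Matrix.GeneralLinearGroup.coe_mul, Matrix.det_mul, Matrix.det_fin_two h.val,
      h0, h1, hC, mul_one, mul_zero, sub_zero]
  have hpow : ∀ N : ℕ, e ^ (N % (Fintype.card F - 1)) = e ^ N := fun N => by
    conv_rhs => rw [← Nat.mod_add_div N (Fintype.card F - 1)]
    rw [pow_add, pow_mul, FiniteField.pow_card_sub_one_eq_one e he0, one_pow, mul_one]
  have hE : ofA F (C e) ^ (n % (Fintype.card F - 1)) * ofA F (C e⁻¹) ^ n = 1 := by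
    simp only [← map_pow, ← map_mul]
    rw [ hpow, ← mul_pow,
      mul_inv_cancel₀ he0, one_pow, C_1, map_one]
  simp only [slash, hj, hd, unif_affine ϖ he0 _ hm, gossPoly_eval_mul, map_mul, mul_pow]
  linear_combination (ofA F (γ : Matrix (Fin 2) (Fin 2) F[X]).det ^ (n % (Fintype.card F - 1))
    / jfac γ z ^ k * (gossPoly ϖ n).eval (unif ϖ (moebius γ z))) * hE

/-- The coset space `H \ Γ`. -/
abbrev Cosets (F : Type*) [Field F] : Type _ := Quotient (QuotientGroup.rightRel (subH F))

/-- The term of the Poincaré series of index `n` and weight `k` at the coset of `γ`, namely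
`(det γ)^m / (c z + d)^k * G_n(u(γ z))` with `m` the reduction of `n` modulo `q - 1`. -/
def poincareTerm (ϖ : CInf F) (k n : ℕ) (z : Omega F) : Cosets F → CInf F :=
  Quotient.lift
    (fun γ => slash k (n % (Fintype.card F - 1)) (fun w => (gossPoly ϖ n).eval (unif ϖ w)) γ z)
    (by
      intro γ δ hγδ
      have hmem : δ * γ⁻¹ ∈ subH F := QuotientGroup.rightRel_apply.1 hγδ
      have := slash_goss_mul ϖ k n z hmem γ
      rw [inv_mul_cancel_right] at this
      exact this.symm)

/-- The Drinfeld-Poincaré series `P_{k,n}`. -/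
def poincare (ϖ : CInf F) (k n : ℕ) (z : Omega F) : CInf F :=
  ∑' γ : Cosets F, poincareTerm ϖ k n z γ

/-! ### Hyperderivatives -/

/-- `f(z + ε) = ∑_n c_n ε^n` for all sufficiently small `ε`. -/
def HasHyperExpansion (f : Omega F → CInf F) (z : Omega F) (c : ℕ → CInf F) : Prop :=
  ∃ r : ℝ, 0 < r ∧ ∀ ε : CInf F, ‖ε‖ < r →
    ∃ h : (z : CInf F) + ε ∈ Omega F, HasSum (fun n => c n * ε ^ n) (f ⟨z + ε, h⟩)

open scoped Classical in
/-- The unaltered hyperderivative `𝒟_n f`: the `n`-th coefficient of the expansion of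
`f(z + ε)` in powers of `ε` (and `0` at points where there is no such expansion). -/
def unalteredHyperderiv (n : ℕ) (f : Omega F → CInf F) (z : Omega F) : CInf F :=
  if h : ∃ c, HasHyperExpansion f z c then h.choose n else 0

/-- The hyperderivative `D_n f = (-1)^n / ϖ^n * 𝒟_n f`. -/
def hyperderiv (ϖ : CInf F) (n : ℕ) (f : Omega F → CInf F) (z : Omega F) : CInf F :=
  (-1) ^ n / ϖ ^ n * unalteredHyperderiv n f z

end Drinfeld

end

/-!
Write `j = c z + d` for the linear form of the bottom row of `γ` and, for `a ∈ A`, let `w` be that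
of its top row plus `a` times the bottom row, so that `γ z + a = w / j`. The Goss polynomials satisfy
`G_N(u(z)) = ϖ⁻ᴺ ∑_a (z + a)⁻ᴺ` (`gossPoly_eval_unif`); hence `P_{l+N,N}(z)` is the double series
`ϖ⁻ᴺ ∑_{γ, a} (det γ)ᴺ / (j^l w^N)`. The pairs of rows are distinct, and `|c z + d|` is at least a
positive multiple of `max(|c|, |d|)` because `K_∞` is closed in `ℂ_∞`; so for `l, N ≥ 1` the terms
tend to zero, and in a complete ultrametric field this is unconditional convergence
(`hasSum_poincareTerm`).

With `k = l + 1`, the same bound lets one expand each term of `P_{k,1}(z + ε)` in powers of `ε` and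
rearrange the resulting triple series (`hasHyperExpansion_poincare`). Everything then reduces to one
coefficient, that of `X ^ n` in `1 / ((j + c X) ^ l (w + a X))`, with `(a, b)` the modified top row.
The congruences on binomial coefficients say that `(j + c X) ^ (l + n)` is the constant `j ^ (l + n)`
modulo `X ^ (n + 1)`, and the coefficient of `X ^ n` in `(j + c X) ^ n / (w + a X)` is
`(c w - a j) ^ n / w ^ (n + 1) = (-det γ) ^ n / w ^ (n + 1)` by the binomial theorem. So the
coefficient is `(-det γ) ^ n / (j ^ (l + n) w ^ (n + 1))` (`coeff_invLinSeries_pow_mul`), which up to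
the factor `(-ϖ) ^ n` is the term of the double series of `P_{k+2n,1+n}`. The congruence for the
index `n` also excludes `k = 1`, the case in which the double series would diverge.

The identity for Goss polynomials is proved for the lattice points of degree less than `d` and passes
to the limit. The finite product `e(X) = X ∏ (1 - X / λ)` is `𝔽_q`-linear with `e' = 1`, so its
logarithmic derivative gives `∑_λ 1 / (Z + λ - Y) = 1 / (e(Z) - e(Y))`; comparing coefficients of
powers of `Y` yields the recursion that defines the Goss polynomials.
-/

open Polynomial Filter Topology
open scoped NNReal

noncomputable section

namespace Drinfeld

variable {F : Type*} [Field F] [Fintype F]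

/-! ### The absolute value on `A` -/

open scoped Classical in
lemma norm_algebraMap_KInf_polynomial {a : F[X]} (ha : a ≠ 0) :
    ‖algebraMap (RatFunc F) (KInf F) (algebraMap F[X] (RatFunc F) a)‖
      = (Fintype.card F : ℝ) ^ a.natDegree := by
  have h : Valued.v (algebraMap (RatFunc F) (RatFunc.CompletionAtInfty F)
      (algebraMap F[X] (RatFunc F) a)) = WithZero.exp (a.natDegree : ℤ) := by
    rw [← RatFunc.inftyValuation.polynomial F ha]
    exact @Valued.extensionValuation_apply_coe _ _ _ _ (RatFunc.inftyValued F) _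
  have h2 : ‖algebraMap (RatFunc F) (KInf F) (algebraMap F[X] (RatFunc F) a)‖
      = (WithZeroMulInt.toNNReal (KInf.one_lt_card F).ne_zero
        (Valued.v (algebraMap (RatFunc F) (RatFunc.CompletionAtInfty F)
          (algebraMap F[X] (RatFunc F) a))) : ℝ) := by
    rw [← Valuation.embedding_restrict (Valued.v (R := RatFunc.CompletionAtInfty F))]
    rfl
  rw [h2, h, WithZeroMulInt.toNNReal_neg_apply _ (by simp)]
  change (((Fintype.card F : ℝ≥0) ^ (a.natDegree : ℤ) : ℝ≥0) : ℝ) = _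
  simp

lemma norm_ofA {a : F[X]} (ha : a ≠ 0) : ‖ofA F a‖ = (Fintype.card F : ℝ) ^ a.natDegree := by
  rw [← norm_algebraMap_KInf_polynomial ha]
  exact norm_algebraMap' (𝕜 := KInf F) (CInf F) _

lemma one_lt_card_real (F : Type*) [Field F] [Fintype F] : (1 : ℝ) < Fintype.card F := by
  exact_mod_cast Fintype.one_lt_card

lemma norm_ofA_C {e : F} (he : e ≠ 0) : ‖ofA F (C e)‖ = 1 := by
  rw [norm_ofA (by simpa using he), natDegree_C, pow_zero]

lemma finite_natDegree_lt (F : Type*) [Field F] [Fintype F] (d : ℕ) :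
    {a : F[X] | a.natDegree < d}.Finite := by
  have : Finite (degreeLT F d) := Finite.of_equiv _ (degreeLTEquiv F d).symm.toEquiv
  refine (Set.toFinite (degreeLT F d : Set F[X])).subset fun a ha => ?_
  rw [SetLike.mem_coe, mem_degreeLT]
  exact degree_le_natDegree.trans_lt (by exact_mod_cast ha)

lemma finite_norm_ofA_le (R : ℝ) : {a : F[X] | ‖ofA F a‖ ≤ R}.Finite := by
  obtain ⟨d, hd⟩ := pow_unbounded_of_one_lt R (one_lt_card_real F)
  refine ((finite_natDegree_lt F d).insert 0).subset fun a ha => ?_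
  rcases eq_or_ne a 0 with rfl | h0
  · exact Set.mem_insert _ _
  refine Set.mem_insert_of_mem _ ?_
  rw [Set.mem_ofPred_eq, norm_ofA h0] at ha
  exact (pow_lt_pow_iff_right₀ (one_lt_card_real F)).1 (ha.trans_lt hd)

/-! ### Linear forms `c z + d` on `Ω` -/

/-- The linear form `c z + d` attached to a pair `x = (c, d)` of elements of `A`. -/
def linForm (x : F[X] × F[X]) (z : CInf F) : CInf F := ofA F x.1 * z + ofA F x.2

lemma linForm_ne_zero {x : F[X] × F[X]} (hx : x ≠ 0) {z : CInf F} (hz : z ∈ Omega F) :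
    linForm x z ≠ 0 := by
  intro h
  have hinj : Function.Injective fun a : F[X] =>
      algebraMap (RatFunc F) (KInf F) (algebraMap F[X] (RatFunc F) a) :=
    (algebraMap (RatFunc F) (KInf F)).injective.comp (IsFractionRing.injective _ _)
  obtain ⟨hc, hd⟩ := eq_zero_of_mul_add_eq_zero hz
      (x := algebraMap (RatFunc F) (KInf F) (algebraMap F[X] (RatFunc F) x.1))
      (y := algebraMap (RatFunc F) (KInf F) (algebraMap F[X] (RatFunc F) x.2)) h
  exact hx (Prod.ext (hinj (by simpa using hc)) (hinj (by simpa using hd)))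

/-- Since `K_∞` is complete, hence closed in `ℂ_∞`, every point of `Ω` has positive distance
from it. -/
lemma exists_pos_le_norm_add {z : CInf F} (hz : z ∈ Omega F) :
    ∃ ρ : ℝ, 0 < ρ ∧ ∀ x : KInf F, ρ ≤ ‖z + algebraMap (KInf F) (CInf F) x‖ := by
  have hcl : IsClosed (Set.range (algebraMap (KInf F) (CInf F))) :=
    ((algebraMap_isometry (KInf F) (CInf F)).isClosedEmbedding).isClosed_range
  obtain ⟨ρ, h0, h⟩ := Metric.isOpen_iff.1 hcl.isOpen_compl z hz
  refine ⟨ρ, h0, fun x => ?_⟩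
  by_contra! hlt
  refine h (a := z - (z + algebraMap (KInf F) (CInf F) x)) ?_ ⟨-x, by simp⟩
  rwa [Metric.mem_ball, dist_comm, dist_eq_norm, sub_sub_cancel]

/-- `|c z + d|` is bounded below by a positive multiple of `max(|c|, |d|)`. -/
lemma exists_norm_linForm_ge {z : CInf F} (hz : z ∈ Omega F) :
    ∃ ρ : ℝ, 0 < ρ ∧ ∀ x : F[X] × F[X],
      ρ * ‖ofA F x.1‖ ≤ ‖linForm x z‖ ∧ ρ * ‖ofA F x.2‖ ≤ ‖linForm x z‖ := by
  obtain ⟨ρ, h0, h⟩ := exists_pos_le_norm_add hz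
  have h1 : ∀ x : F[X] × F[X], ρ * ‖ofA F x.1‖ ≤ ‖linForm x z‖ := by
    intro x
    rcases eq_or_ne x.1 0 with hx | hx
    · simp [hx]
    have hx' : ofA F x.1 ≠ 0 := (map_ne_zero_iff _ ofA_injective).2 hx
    have h2 := h (algebraMap (RatFunc F) (KInf F) (algebraMap F[X] (RatFunc F) x.2)
      / algebraMap (RatFunc F) (KInf F) (algebraMap F[X] (RatFunc F) x.1))
    rw [map_div₀] at h2
    change ρ ≤ ‖z + ofA F x.2 / ofA F x.1‖ at h2
    have h3 : linForm x z = (z + ofA F x.2 / ofA F x.1) * ofA F x.1 := by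
      rw [linForm]; field_simp
    rw [h3, norm_mul]
    gcongr
  set M := max 1 (‖z‖ / ρ) with hM
  have hM0 : 0 < M := lt_max_of_lt_left one_pos
  have h2 : ∀ x : F[X] × F[X], ‖ofA F x.2‖ ≤ M * ‖linForm x z‖ := by
    intro x
    have h3 : ofA F x.2 = linForm x z - ofA F x.1 * z := by rw [linForm]; ring
    rw [h3, sub_eq_add_neg]
    refine (IsUltrametricDist.norm_add_le_max _ _).trans (max_le ?_ ?_)
    · exact le_mul_of_one_le_left (norm_nonneg _) (le_max_left _ _)
    · calc ‖-(ofA F x.1 * z)‖ = ‖z‖ / ρ * (ρ * ‖ofA F x.1‖) := by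
            rw [norm_neg, norm_mul]; field_simp
        _ ≤ M * ‖linForm x z‖ := by
            gcongr
            · exact le_max_right _ _
            · exact h1 x
  refine ⟨min ρ M⁻¹, lt_min h0 (inv_pos.2 hM0), fun x => ⟨?_, ?_⟩⟩
  · exact (mul_le_mul_of_nonneg_right (min_le_left _ _) (norm_nonneg _)).trans (h1 x)
  · refine (mul_le_mul_of_nonneg_right (min_le_right _ _) (norm_nonneg _)).trans ?_
    rw [inv_mul_le_iff₀ hM0]
    exact h2 x

lemma finite_norm_linForm_le {z : CInf F} (hz : z ∈ Omega F) (R : ℝ) :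
    {x : F[X] × F[X] | ‖linForm x z‖ ≤ R}.Finite := by
  obtain ⟨ρ, h0, h⟩ := exists_norm_linForm_ge hz
  refine ((finite_norm_ofA_le (R / ρ)).prod (finite_norm_ofA_le (R / ρ))).subset fun x hx => ?_
  rw [Set.mem_ofPred_eq] at hx
  constructor <;> rw [Set.mem_ofPred_eq, le_div_iff₀ h0, mul_comm]
  exacts [(h x).1.trans hx, (h x).2.trans hx]

/-- A family in `ℂ_∞` whose absolute values tend to infinity has summable inverse powers. -/
lemma summable_inv_pow_of_finite {ι : Type*} {f : ι → CInf F}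
    (hf : ∀ R : ℝ, {i | ‖f i‖ ≤ R}.Finite) {m : ℕ} (hm : m ≠ 0) :
    Summable fun i => (f i ^ m)⁻¹ := by
  apply NonarchimedeanAddGroup.summable_of_tendsto_cofinite_zero
  have h1 : Tendsto (fun i => ‖f i‖) cofinite atTop := by
    refine tendsto_atTop.2 fun R => ?_
    filter_upwards [(hf R).compl_mem_cofinite] with i hi
    exact (not_le.1 (show ¬ ‖f i‖ ≤ R from hi)).le
  rw [tendsto_zero_iff_norm_tendsto_zero]
  simp only [norm_inv, norm_pow]
  exact tendsto_inv_atTop_zero.comp ((tendsto_pow_atTop hm).comp h1)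

lemma summable_inv_linForm_pow {z : CInf F} (hz : z ∈ Omega F) {m : ℕ} (hm : m ≠ 0) :
    Summable fun x : F[X] × F[X] => (linForm x z ^ m)⁻¹ :=
  summable_inv_pow_of_finite (finite_norm_linForm_le hz) hm

lemma summable_inv_add_ofA_pow {z : CInf F} (hz : z ∈ Omega F) {m : ℕ} (hm : m ≠ 0) :
    Summable fun a : F[X] => ((z + ofA F a) ^ m)⁻¹ := by
  have h := (summable_inv_linForm_pow hz hm).comp_injective
    (i := fun a : F[X] => ((1, a) : F[X] × F[X])) fun a b hab => (Prod.ext_iff.1 hab).2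
  simpa [Function.comp_def, linForm] using h

/-! ### `𝔽_q`-linear polynomials -/

variable (F) in
/-- The `𝔽_q`-linear polynomials over `ℂ_∞`: the linear combinations of the `X ^ (q ^ i)`. -/
def qLinear : Submodule (CInf F) (CInf F)[X] :=
  Submodule.span (CInf F) (Set.range fun i : ℕ => (X : (CInf F)[X]) ^ Fintype.card F ^ i)

lemma qLinear_coeff_eq_zero {P : (CInf F)[X]} (hP : P ∈ qLinear F) {j : ℕ}
    (hj : ∀ i, j ≠ Fintype.card F ^ i) : P.coeff j = 0 := by
  induction hP using Submodule.span_induction with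
  | mem x h =>
    obtain ⟨i, rfl⟩ := h
    rw [coeff_X_pow, if_neg (hj i)]
  | zero => simp
  | add x y _ _ hx hy => rw [coeff_add, hx, hy, add_zero]
  | smul c x _ hx => rw [coeff_smul, hx, smul_zero]

lemma qLinear_eval_mul {P : (CInf F)[X]} (hP : P ∈ qLinear F) (c : F) (y : CInf F) :
    P.eval (ofA F (C c) * y) = ofA F (C c) * P.eval y := by
  induction hP using Submodule.span_induction with
  | mem x h =>
    obtain ⟨i, rfl⟩ := h
    simp only [eval_pow, eval_X]
    rw [mul_pow, ← map_pow, ← C_pow, FiniteField.pow_card_pow]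
  | zero => simp
  | add x y _ _ hx hy => rw [eval_add, eval_add, hx, hy, mul_add]
  | smul c x _ hx => rw [eval_smul, eval_smul, hx, smul_eq_mul, smul_eq_mul]; ring

lemma sub_pow_card_pow {R : Type*} [CommRing R] [Nontrivial R] (φ : F →+* R) (x y : R) (i : ℕ) :
    (x - y) ^ Fintype.card F ^ i = x ^ Fintype.card F ^ i - y ^ Fintype.card F ^ i := by
  obtain ⟨p, f, hF, hp, hf⟩ := FiniteField.card' F
  have := Fact.mk hp
  have := charP_of_injective_ringHom φ.injective p
  rw [hf, ← pow_mul, sub_pow_expChar_pow]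

variable (F) in
/-- The inclusion of `𝔽_q` into the polynomial ring over `ℂ_∞`. -/
def constHom : F →+* (CInf F)[X] := C.comp ((ofA F).comp C)

lemma qLinear_comp_sub {P : (CInf F)[X]} (hP : P ∈ qLinear F) (A B : (CInf F)[X]) :
    P.comp (A - B) = P.comp A - P.comp B := by
  induction hP using Submodule.span_induction with
  | mem x h =>
    obtain ⟨i, rfl⟩ := h
    simp only [pow_comp, X_comp]
    exact sub_pow_card_pow (constHom F) A B i
  | zero => simp
  | add x y _ _ hx hy => rw [add_comp, add_comp, add_comp, hx, hy]; ring
  | smul c x _ hx => rw [smul_comp, smul_comp, smul_comp, hx, smul_sub]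

lemma qLinear_derivative {P : (CInf F)[X]} (hP : P ∈ qLinear F) :
    derivative P = C (P.coeff 1) := by
  induction hP using Submodule.span_induction with
  | mem x h =>
    obtain ⟨i, rfl⟩ := h
    rcases eq_or_ne i 0 with rfl | hi
    · simp
    · have h0 : ((Fintype.card F ^ i : ℕ) : CInf F) = 0 := by
        have h := congrArg ((ofA F).comp C) (FiniteField.cast_card_eq_zero F)
        rw [map_natCast, map_zero] at h
        rw [Nat.cast_pow, h, zero_pow hi]
      have h1 : 1 ≠ Fintype.card F ^ i := (Nat.one_lt_pow hi Fintype.one_lt_card).ne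
      simp only [derivative_X_pow, coeff_X_pow, if_neg h1, h0, map_zero, zero_mul]
  | zero => simp
  | add x y _ _ hx hy => rw [derivative_add, coeff_add, hx, hy, C_add]
  | smul c x _ hx => rw [derivative_smul, coeff_smul, hx, smul_C]

lemma qLinear_pow_card {P : (CInf F)[X]} (hP : P ∈ qLinear F) :
    P ^ Fintype.card F ∈ qLinear F := by
  have key := fun x y => sub_pow_card_pow (constHom F) x y 1
  simp only [pow_one] at key
  have h0 : (0 : (CInf F)[X]) ^ Fintype.card F = 0 := zero_pow Fintype.card_ne_zero
  induction hP using Submodule.span_induction with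
  | mem x h =>
    obtain ⟨i, rfl⟩ := h
    exact Submodule.subset_span ⟨i + 1, by simp only [pow_succ, pow_mul]⟩
  | zero => rw [h0]; exact zero_mem _
  | add x y _ _ hx hy =>
    have h1 : (x + y) ^ Fintype.card F = x ^ Fintype.card F - (0 - y ^ Fintype.card F) := by
      rw [← h0, ← key, ← key]; congr 1; ring
    rw [h1]
    exact sub_mem hx (sub_mem (zero_mem _) hy)
  | smul c x _ hx => rw [_root_.smul_pow]; exact Submodule.smul_mem _ _ hx

/-! ### The finite-level exponentials of the lattice `ϖ A` -/

/-- The finite `𝔽_q`-subspace of polynomials of degree less than `d`. As `natDegree 0 = 0`, zero is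
adjoined by hand, which matters for `d = 0`. -/
def lowDeg (F : Type*) [Field F] [Fintype F] (d : ℕ) : Finset F[X] :=
  ((finite_natDegree_lt F d).insert 0).toFinset

lemma mem_lowDeg {d : ℕ} {a : F[X]} : a ∈ lowDeg F d ↔ a = 0 ∨ a.natDegree < d := by
  simp [lowDeg]

lemma mem_lowDeg_iff_coeff {d : ℕ} {a : F[X]} :
    a ∈ lowDeg F d ↔ ∀ m, d ≤ m → a.coeff m = 0 := by
  rw [mem_lowDeg, ← degree_lt_iff_coeff_zero]
  rcases eq_or_ne a 0 with rfl | h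
  · simp
  · simp [h, natDegree_lt_iff_degree_lt h]

lemma lowDeg_mono : Monotone (lowDeg F) := fun d e hde a => by
  simp only [mem_lowDeg]
  exact Or.imp_right fun h => h.trans_le hde

lemma tendsto_lowDeg : Tendsto (lowDeg F) atTop atTop :=
  tendsto_atTop_finset_of_monotone lowDeg_mono fun a =>
    ⟨a.natDegree + 1, mem_lowDeg.2 (Or.inr (Nat.lt_succ_self _))⟩

lemma zero_mem_lowDeg (d : ℕ) : (0 : F[X]) ∈ lowDeg F d := mem_lowDeg.2 (Or.inl rfl)

lemma prod_lowDeg_succ {M : Type*} [CommMonoid M] (d : ℕ) (f : F[X] → M) :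
    ∏ a ∈ lowDeg F (d + 1), f a = ∏ c : F, ∏ a ∈ lowDeg F d, f (a + C c * X ^ d) := by
  rw [← Finset.prod_product']
  symm
  refine Finset.prod_nbij' (fun x => x.2 + C x.1 * X ^ d)
    (fun b => (b.coeff d, b - C (b.coeff d) * X ^ d)) ?_ ?_ ?_ ?_ ?_
  · rintro ⟨c, a⟩ h
    rw [Finset.mem_product, mem_lowDeg_iff_coeff] at h
    rw [mem_lowDeg_iff_coeff]
    intro m hm
    have : m ≠ d := by omega
    simp [coeff_X_pow, this, h.2 m (by omega)]
  · intro b h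
    rw [mem_lowDeg_iff_coeff] at h
    rw [Finset.mem_product, mem_lowDeg_iff_coeff]
    refine ⟨Finset.mem_univ _, fun m hm => ?_⟩
    rcases hm.eq_or_lt with rfl | hm
    · simp
    · simp [coeff_X_pow, hm.ne', h m hm]
  · rintro ⟨c, a⟩ h
    rw [Finset.mem_product, mem_lowDeg_iff_coeff] at h
    have h1 : a.coeff d = 0 := h.2 d le_rfl
    simp [h1]
  · intro b _
    simp
  · intro _ _
    rfl

/-- The homogeneous form of `∏_{c ∈ 𝔽_q} (X - c) = X ^ q - X`. -/
lemma prod_sub_C_mul (Y : (CInf F)[X]) (w : CInf F) :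
    ∏ c : F, (Y - C (ofA F (C c) * w))
      = Y ^ Fintype.card F - C (w ^ (Fintype.card F - 1)) * Y := by
  have hq : Fintype.card F - 1 ≠ 0 := by have := Fintype.one_lt_card (α := F); omega
  rcases eq_or_ne w 0 with rfl | hw
  · simp [zero_pow hq]
  have h1 : ∀ Y : (CInf F)[X], ∏ c : F, (Y - C (ofA F (C c))) = Y ^ Fintype.card F - Y := by
    intro Y
    have h0 : ∏ c : F, (X - C c) = (X ^ Fintype.card F - X : F[X]) := by
      have hdeg := FiniteField.X_pow_card_sub_X_natDegree_eq F (Fintype.one_lt_card (α := F))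
      have hmonic : (X ^ Fintype.card F - X : F[X]).Monic :=
        monic_X_pow_sub (by rw [degree_X]; exact_mod_cast Fintype.one_lt_card)
      have hroots := FiniteField.roots_X_pow_card_sub_X F
      have h := prod_multiset_X_sub_C_of_monic_of_roots_card_eq hmonic
        (by rw [hroots, hdeg]; rfl)
      rwa [hroots] at h
    have h := congrArg (eval₂ (constHom F) Y) h0
    simpa [eval₂_finsetProd, constHom] using h
  have h2 : Y = C w * (C w⁻¹ * Y) := by
    rw [← mul_assoc, ← C_mul, mul_inv_cancel₀ hw, C_1, one_mul]
  have h3 : ∀ c : F, Y - C (ofA F (C c) * w) = C w * (C w⁻¹ * Y - C (ofA F (C c))) := by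
    intro c
    rw [mul_sub, ← h2, C_mul]; ring
  simp only [h3]
  rw [Finset.prod_mul_distrib, h1, Finset.prod_const, Finset.card_univ, mul_sub, ← mul_pow, ← h2]
  congr 1
  obtain ⟨r, hr⟩ : ∃ r, Fintype.card F = r + 1 := ⟨Fintype.card F - 1, by omega⟩
  rw [hr, pow_succ, mul_assoc, ← h2, C_pow, Nat.add_sub_cancel]

/-- The monic polynomial whose roots are the lattice points of degree less than `d`. -/
def latticePoly (ϖ : CInf F) (d : ℕ) : (CInf F)[X] :=
  ∏ a ∈ lowDeg F d, (X - C (ϖ * ofA F a))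

/-- The product over the nonzero lattice points of degree less than `d` whose limit
is `e_Λ(X) / X`. -/
def latticeExpQuot (ϖ : CInf F) (d : ℕ) : (CInf F)[X] :=
  open scoped Classical in
  ∏ a ∈ (lowDeg F d).erase 0, (1 - C (ϖ * ofA F a)⁻¹ * X)

/-- The finite-level lattice exponential. -/
def latticeExp (ϖ : CInf F) (d : ℕ) : (CInf F)[X] := X * latticeExpQuot ϖ d

lemma latticeExpCoeff_eq_limUnder (ϖ : CInf F) (j : ℕ) :
    latticeExpCoeff ϖ j = limUnder atTop fun d : ℕ => (latticeExp ϖ d).coeff j := by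
  classical
  rw [latticeExpCoeff]
  congr 1
  funext d
  have h : {a : F[X] | a ≠ 0 ∧ a.natDegree < d} = ((lowDeg F d).erase 0 : Finset F[X]) := by
    ext a
    simp only [Set.mem_ofPred_eq, Finset.coe_erase, Set.mem_sdiff, Finset.mem_coe, mem_lowDeg,
      Set.mem_singleton_iff]
    tauto
  rw [h, finprod_mem_coe_finset, latticeExp, latticeExpQuot]

lemma exists_latticeExp_eq {ϖ : CInf F} (hϖ : ϖ ≠ 0) (d : ℕ) :
    ∃ κ : CInf F, latticeExp ϖ d = C κ * latticePoly ϖ d := by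
  classical
  refine ⟨∏ a ∈ (lowDeg F d).erase 0, -(ϖ * ofA F a)⁻¹, ?_⟩
  rw [latticeExp, latticePoly, latticeExpQuot, ← Finset.mul_prod_erase _ _ (zero_mem_lowDeg d),
    map_prod, mul_left_comm, ← Finset.prod_mul_distrib]
  simp only [map_zero, mul_zero, sub_zero]
  congr 1
  refine Finset.prod_congr rfl fun a ha => ?_
  have h0 : ϖ * ofA F a ≠ 0 :=
    mul_ne_zero hϖ ((map_ne_zero_iff _ ofA_injective).2 (Finset.ne_of_mem_erase ha))
  have h1 : C (ϖ * ofA F a)⁻¹ * C (ϖ * ofA F a) = 1 := by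
    rw [← C_mul, inv_mul_cancel₀ h0, C_1]
  rw [C_neg]
  linear_combination -h1

lemma latticeExp_coeff_one (ϖ : CInf F) (d : ℕ) : (latticeExp ϖ d).coeff 1 = 1 := by
  rw [latticeExp, coeff_X_mul, coeff_zero_eq_eval_zero, latticeExpQuot, eval_prod]
  simp

lemma latticePoly_mem_qLinear (ϖ : CInf F) (d : ℕ) : latticePoly ϖ d ∈ qLinear F := by
  induction d with
  | zero =>
    have h : lowDeg F 0 = {0} := by ext a; simp [mem_lowDeg]
    exact Submodule.subset_span ⟨0, by simp [latticePoly, h]⟩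
  | succ d ih =>
    -- `V_{d+1} = V_d + 𝔽_q T^d`, so that `Q_{d+1} = ∏_c (Q_d - c Q_d(ϖ T^d))`
    have h : ∀ c : F, ∏ a ∈ lowDeg F d, (X - C (ϖ * ofA F (a + C c * X ^ d)))
        = latticePoly ϖ d - C (ofA F (C c) * (latticePoly ϖ d).eval (ϖ * ofA F (X ^ d))) := by
      intro c
      have h1 : (latticePoly ϖ d).comp (X - C (ofA F (C c) * (ϖ * ofA F (X ^ d))))
          = ∏ a ∈ lowDeg F d, (X - C (ϖ * ofA F (a + C c * X ^ d))) := by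
        rw [latticePoly, prod_comp]
        refine Finset.prod_congr rfl fun a _ => ?_
        rw [sub_comp, X_comp, C_comp, sub_sub, ← C_add, map_add (ofA F), map_mul (ofA F)]
        congr 2
        ring
      rw [← h1, qLinear_comp_sub ih, comp_X, comp_C, qLinear_eval_mul ih]
    rw [latticePoly, prod_lowDeg_succ]
    simp only [h]
    rw [prod_sub_C_mul, ← smul_eq_C_mul]
    exact sub_mem (qLinear_pow_card ih) (Submodule.smul_mem _ _ ih)

lemma latticeExp_mem_qLinear {ϖ : CInf F} (hϖ : ϖ ≠ 0) (d : ℕ) :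
    latticeExp ϖ d ∈ qLinear F := by
  obtain ⟨κ, h⟩ := exists_latticeExp_eq hϖ d
  rw [h, ← smul_eq_C_mul]
  exact Submodule.smul_mem _ _ (latticePoly_mem_qLinear ϖ d)

/-! ### Convergence of the coefficients of the lattice exponential -/

/-- The Gauss-type bound `|f_j| ≤ M ^ j` on coefficients is stable under products, by the
ultrametric inequality. -/
lemma norm_coeff_mul_le {M : ℝ} (hM : 0 ≤ M) {f g : (CInf F)[X]} {B : ℝ} (hB : 0 ≤ B)
    (hf : ∀ j, ‖f.coeff j‖ ≤ M ^ j) (hg : ∀ j, ‖g.coeff j‖ ≤ B * M ^ j) (j : ℕ) :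
    ‖(f * g).coeff j‖ ≤ B * M ^ j := by
  rw [coeff_mul]
  refine IsUltrametricDist.norm_sum_le_of_forall_le_of_nonneg (by positivity) fun x hx => ?_
  rw [norm_mul, ← Finset.HasAntidiagonal.mem_antidiagonal.1 hx, pow_add, mul_left_comm]
  exact mul_le_mul (hf _) (hg _) (norm_nonneg _) (by positivity)

lemma norm_coeff_prod_le {M : ℝ} (hM : 0 ≤ M) {ι : Type*} (s : Finset ι) (t : ι → CInf F)
    (ht : ∀ i ∈ s, ‖t i‖ ≤ M) (j : ℕ) :
    ‖(∏ i ∈ s, (1 - C (t i) * X : (CInf F)[X])).coeff j‖ ≤ M ^ j := by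
  classical
  induction s using Finset.induction_on generalizing j with
  | empty =>
    rw [Finset.prod_empty, coeff_one]
    split_ifs with h
    · simp [h]
    · simpa using pow_nonneg hM j
  | insert i s hi ih =>
    rw [Finset.prod_insert hi, ← one_mul (M ^ j)]
    refine norm_coeff_mul_le hM zero_le_one (fun j => ?_) (fun j => ?_) j
    · rcases j with _ | _ | j
      · simp
      · simpa [coeff_one] using ht i (Finset.mem_insert_self _ _)
      · simpa [coeff_one, coeff_X] using pow_nonneg hM _
    · rw [one_mul]
      exact ih (fun k hk => ht k (Finset.mem_insert_of_mem hk)) j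

lemma tendsto_latticeExp_coeff (ϖ : CInf F) (j : ℕ) :
    Tendsto (fun d => (latticeExp ϖ d).coeff j) atTop (𝓝 (latticeExpCoeff ϖ j)) := by
  classical
  suffices h : ∃ l, Tendsto (fun d => (latticeExp ϖ d).coeff j) atTop (𝓝 l) by
    rw [latticeExpCoeff_eq_limUnder]
    exact tendsto_nhds_limUnder h
  rcases j with _ | j
  · exact ⟨0, by simp [latticeExp]⟩
  simp only [latticeExp, coeff_X_mul]
  apply cauchySeq_tendsto_of_complete
  apply NonarchimedeanAddGroup.cauchySeq_of_tendsto_sub_nhds_zero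
  set q : ℝ := (Fintype.card F : ℝ)
  have hq1 : 1 < q := one_lt_card_real F
  set M : ℝ := ‖ϖ‖⁻¹ with hM
  have hM0 : 0 ≤ M := by positivity
  have hbound : ∀ a : F[X], a ≠ 0 → ‖(ϖ * ofA F a)⁻¹‖ = M * (q ^ a.natDegree)⁻¹ := by
    intro a ha
    rw [norm_inv, norm_mul, mul_inv, norm_ofA ha]
  have key : ∀ d, ‖(latticeExpQuot ϖ (d + 1)).coeff j - (latticeExpQuot ϖ d).coeff j‖
      ≤ (q ^ d)⁻¹ * M ^ j := by
    intro d
    have h1 : ∀ i, ‖(latticeExpQuot ϖ d).coeff i‖ ≤ M ^ i := by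
      refine norm_coeff_prod_le hM0 _ _ fun a ha => ?_
      rw [hbound a (Finset.ne_of_mem_erase ha)]
      exact mul_le_of_le_one_right hM0 (inv_le_one_of_one_le₀ (one_le_pow₀ hq1.le))
    -- the factors of degree exactly `d`
    set R : (CInf F)[X] := ∏ a ∈ (lowDeg F (d + 1)).erase 0 \ (lowDeg F d).erase 0,
      (1 - C (ϖ * ofA F a)⁻¹ * X) with hR
    have h2 : ∀ i, ‖R.coeff i‖ ≤ (M * (q ^ d)⁻¹) ^ i := by
      refine norm_coeff_prod_le (by positivity) _ _ fun a ha => ?_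
      simp only [Finset.mem_sdiff, Finset.mem_erase, mem_lowDeg] at ha
      have hd : a.natDegree = d := by
        have := ha.1.1
        by_contra hne
        exact ha.2 ⟨this, Or.inr (by rcases ha.1.2 with h | h <;> [contradiction; omega])⟩
      rw [hbound a ha.1.1, hd]
    have h3 : ∀ i, ‖(R - 1).coeff i‖ ≤ (q ^ d)⁻¹ * M ^ i := by
      intro i
      rcases i with _ | i
      · have : R.coeff 0 = 1 := by
          rw [coeff_zero_eq_eval_zero, hR, eval_prod]; simp
        rw [coeff_sub, this]
        simp
        positivity
      · rw [coeff_sub, coeff_one, if_neg (by omega), sub_zero]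
        refine (h2 _).trans ?_
        rw [mul_pow, mul_comm]
        gcongr
        exact pow_le_of_le_one (by positivity) (inv_le_one_of_one_le₀ (one_le_pow₀ hq1.le))
          (by omega)
    have h4 : latticeExpQuot ϖ (d + 1) = R * latticeExpQuot ϖ d :=
      (Finset.prod_sdiff (Finset.erase_subset_erase _ (lowDeg_mono d.le_succ))).symm
    have h5 : (latticeExpQuot ϖ (d + 1)).coeff j - (latticeExpQuot ϖ d).coeff j
        = (latticeExpQuot ϖ d * (R - 1)).coeff j := by
      rw [← coeff_sub, h4]
      congr 1
      ring
    rw [h5]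
    exact norm_coeff_mul_le hM0 (by positivity) h1 h3 j
  refine squeeze_zero_norm key ?_
  have : Tendsto (fun d : ℕ => (q⁻¹) ^ d * M ^ j) atTop (𝓝 (0 * M ^ j)) :=
    (tendsto_pow_atTop_nhds_zero_of_lt_one (by positivity) (inv_lt_one_of_one_lt₀ hq1)).mul_const _
  simpa using this

/-! ### Goss polynomials and lattice sums -/

/-- The partial fraction expansion `∑_λ 1 / (Z + λ - Y) = 1 / (e(Z) - e(Y))` as formal power series
in `Y`, where `e` is a finite-level exponential: this is the logarithmic derivative of `e(Y - Z)`,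
as `e' = 1`. -/
lemma sub_latticeExp_mul_sum_inv {ϖ : CInf F} (hϖ : ϖ ≠ 0) (d : ℕ) {Z : CInf F}
    (hZ : ∀ a, Z + ϖ * ofA F a ≠ 0) :
    (PowerSeries.C ((latticeExp ϖ d).eval Z) - (latticeExp ϖ d : PowerSeries (CInf F)))
      * PowerSeries.mk (fun n => ∑ a ∈ lowDeg F d, ((Z + ϖ * ofA F a) ^ (n + 1))⁻¹) = 1 := by
  classical
  set E := latticeExp ϖ d with hE
  have hlin : E ∈ qLinear F := latticeExp_mem_qLinear hϖ d
  obtain ⟨κ, hκ⟩ := exists_latticeExp_eq hϖ d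
  -- `P(Y) = e(Y - Z)`
  set P : (CInf F)[X] := C κ * ∏ a ∈ lowDeg F d, (X - C (Z + ϖ * ofA F a)) with hP
  have h1 : P = E - C (E.eval Z) := by
    have h : E.comp (X - C Z) = P := by
      rw [hE, hκ, latticePoly, mul_comp, C_comp, prod_comp, hP]
      congr 1
      refine Finset.prod_congr rfl fun a _ => ?_
      rw [sub_comp, X_comp, C_comp, sub_sub, ← C_add]
    rw [← h, qLinear_comp_sub hlin, comp_X, comp_C]
  have h2 : C κ * ∑ a ∈ lowDeg F d, ∏ b ∈ (lowDeg F d).erase a, (X - C (Z + ϖ * ofA F b)) = 1 := by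
    have h : derivative P = 1 := by
      rw [h1, derivative_sub, derivative_C, sub_zero, qLinear_derivative hlin, hE,
        latticeExp_coeff_one, C_1]
    rw [← h, hP, derivative_C_mul, derivative_prod_finset]
    simp
  let I : F[X] → PowerSeries (CInf F) := fun a =>
    PowerSeries.mk fun n => ((Z + ϖ * ofA F a) ^ (n + 1))⁻¹
  have hI : ∀ a, ((X - C (Z + ϖ * ofA F a) : (CInf F)[X]) : PowerSeries (CInf F)) * I a = -1 := by
    intro a
    ext n
    rw [Polynomial.coe_sub, Polynomial.coe_X, Polynomial.coe_C, sub_mul, map_sub,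
      PowerSeries.coeff_C_mul]
    have := hZ a
    rcases n with _ | n
    · simp [I, this]
    · rw [PowerSeries.coeff_succ_X_mul]
      simp only [I, PowerSeries.coeff_mk, map_neg, PowerSeries.coeff_one]
      simp
      rw [sub_eq_zero, pow_succ (Z + ϖ * ofA F a) (n + 1)]
      field_simp
  have h3 : PowerSeries.mk (fun n => ∑ a ∈ lowDeg F d, ((Z + ϖ * ofA F a) ^ (n + 1))⁻¹)
      = ∑ a ∈ lowDeg F d, I a := by
    ext n
    simp [I]
  have h4 : PowerSeries.C (E.eval Z) - (E : PowerSeries (CInf F)) = -(P : PowerSeries (CInf F)) := by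
    rw [h1, Polynomial.coe_sub, Polynomial.coe_C, neg_sub]
  have h5 : ∀ a ∈ lowDeg F d, (P : PowerSeries (CInf F)) * I a
      = -((C κ * ∏ b ∈ (lowDeg F d).erase a, (X - C (Z + ϖ * ofA F b)) : (CInf F)[X]) :
          PowerSeries (CInf F)) := by
    intro a ha
    rw [hP, ← Finset.mul_prod_erase _ _ ha, mul_left_comm, Polynomial.coe_mul, mul_right_comm, hI,
      neg_one_mul]
  rw [h3, h4, Finset.mul_sum]
  simp only [neg_mul]
  rw [Finset.sum_neg_distrib, Finset.sum_congr rfl h5, Finset.sum_neg_distrib, neg_neg]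
  rw [← Polynomial.coe_one, ← h2, Finset.mul_sum]
  exact (map_sum (Polynomial.coeToPowerSeries.ringHom (R := CInf F)) _ _).symm

/-- The recursion of the Goss polynomials for sums over finitely many lattice points: the coefficient
of `Y ^ (m + 1)` in the partial fraction identity, divided by `e(Z) = 1 / s 1`. -/
lemma sum_lowDeg_recursion {ϖ : CInf F} (hϖ : ϖ ≠ 0) (d m : ℕ) {Z : CInf F}
    (hZ : ∀ a, Z + ϖ * ofA F a ≠ 0) (s : ℕ → CInf F)
    (hs : s = fun k => ∑ a ∈ lowDeg F d, ((Z + ϖ * ofA F a) ^ k)⁻¹) :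
    s (m + 2) = s 1 * ∑ i ∈ Finset.range (m + 2), (latticeExp ϖ d).coeff i * s (m + 2 - i) := by
  have h := sub_latticeExp_mul_sum_inv hϖ d hZ
  have hs' : PowerSeries.mk (fun n => ∑ a ∈ lowDeg F d, ((Z + ϖ * ofA F a) ^ (n + 1))⁻¹)
      = PowerSeries.mk fun n => s (n + 1) := by rw [hs]
  rw [hs', sub_mul] at h
  have h0 : (latticeExp ϖ d).eval Z * s 1 = 1 := by
    have := congrArg (PowerSeries.coeff 0) h
    simpa [PowerSeries.coeff_mul, latticeExp] using this
  have h1 := congrArg (PowerSeries.coeff (m + 1)) h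
  rw [map_sub, PowerSeries.coeff_C_mul, PowerSeries.coeff_mk, PowerSeries.coeff_mul,
    Finset.Nat.sum_antidiagonal_eq_sum_range_succ_mk, PowerSeries.coeff_one, if_neg (by omega)] at h1
  have h2 : ∑ i ∈ Finset.range (m + 2), (latticeExp ϖ d).coeff i * s (m + 2 - i)
      = (latticeExp ϖ d).eval Z * s (m + 2) := by
    rw [sub_eq_zero.1 h1]
    refine Finset.sum_congr rfl fun i hi => ?_
    rw [Finset.mem_range] at hi
    simp only [Polynomial.coeff_coe, PowerSeries.coeff_mk]
    congr 2
    omega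
  rw [h2]
  linear_combination -s (m + 2) * h0

/-- The defining property of Goss polynomials: `G_k(u(z)) = ϖ⁻ᵏ ∑_a (z + a)⁻ᵏ`. -/
lemma gossPoly_eval_unif {ϖ : CInf F} (hϖ : ϖ ≠ 0) (z : Omega F) {k : ℕ} (hk : k ≠ 0) :
    (gossPoly ϖ k).eval (unif ϖ z) = (ϖ ^ k)⁻¹ * ∑' a : F[X], (((z : CInf F) + ofA F a) ^ k)⁻¹ := by
  set S : ℕ → CInf F := fun k => (ϖ ^ k)⁻¹ * ∑' a : F[X], (((z : CInf F) + ofA F a) ^ k)⁻¹ with hS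
  have hu : unif ϖ z = S 1 := by simp [unif, hS]
  have hZ : ∀ a, ϖ * (z : CInf F) + ϖ * ofA F a ≠ 0 := by
    intro a
    rw [← mul_add]
    refine mul_ne_zero hϖ ?_
    have := linForm_ne_zero (x := (1, a)) (by simp) z.2
    simpa [linForm] using this
  let s : ℕ → ℕ → CInf F := fun d k =>
    ∑ a ∈ lowDeg F d, ((ϖ * (z : CInf F) + ϖ * ofA F a) ^ k)⁻¹
  have hlim : ∀ k, k ≠ 0 → Tendsto (fun d => s d k) atTop (𝓝 (S k)) := by
    intro k hk
    have h := ((summable_inv_add_ofA_pow z.2 hk).hasSum.mul_left (ϖ ^ k)⁻¹).comp tendsto_lowDeg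
    refine h.congr fun d => ?_
    simp only [s, Function.comp_apply]
    refine Finset.sum_congr rfl fun a _ => ?_
    rw [← mul_add, mul_pow, mul_inv]
  have hrec : ∀ m, S (m + 2)
      = S 1 * ∑ i ∈ Finset.range (m + 2), latticeExpCoeff ϖ i * S (m + 2 - i) := by
    intro m
    refine tendsto_nhds_unique (hlim (m + 2) (by omega)) ?_
    have h : Tendsto (fun d => s d 1 * ∑ i ∈ Finset.range (m + 2),
        (latticeExp ϖ d).coeff i * s d (m + 2 - i)) atTop
        (𝓝 (S 1 * ∑ i ∈ Finset.range (m + 2), latticeExpCoeff ϖ i * S (m + 2 - i))) := by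
      refine (hlim 1 one_ne_zero).mul (tendsto_finsetSum _ fun i hi => ?_)
      rw [Finset.mem_range] at hi
      exact (tendsto_latticeExp_coeff ϖ i).mul (hlim _ (by omega))
    exact h.congr fun d => (sum_lowDeg_recursion hϖ d m hZ (s d) rfl).symm
  have hzero : ∀ j, (∀ i, j ≠ Fintype.card F ^ i) → latticeExpCoeff ϖ j = 0 := by
    intro j hj
    refine tendsto_nhds_unique (tendsto_latticeExp_coeff ϖ j) ?_
    refine tendsto_const_nhds.congr fun d => ?_
    exact (qLinear_coeff_eq_zero (latticeExp_mem_qLinear hϖ d) hj).symm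
  change _ = S k
  rw [hu]
  induction k using Nat.strong_induction_on with
  | _ k ih =>
    match k with
    | 0 => exact absurd rfl hk
    | 1 => simp [gossPoly]
    | m + 2 =>
      simp only [gossPoly, eval_mul, eval_X]
      rw [eval_finsetSum, hrec]
      congr 1
      have hinj : Function.Injective fun i : ℕ => Fintype.card F ^ i :=
        Nat.pow_right_injective Fintype.one_lt_card
      have h1 : ∀ i ∈ Finset.range (m + 2),
          eval (S 1) (if Fintype.card F ^ i < m + 2 then C (latticeExpCoeff ϖ (Fintype.card F ^ i))
            * gossPoly ϖ (m + 2 - Fintype.card F ^ i) else 0)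
          = if Fintype.card F ^ i < m + 2 then latticeExpCoeff ϖ (Fintype.card F ^ i)
            * S (m + 2 - Fintype.card F ^ i) else 0 := by
        intro i _
        have hpos := card_pow_pos F i
        split_ifs with h
        · rw [eval_mul, eval_C, ih _ (by omega) (by omega)]
        · simp
      rw [Finset.sum_congr rfl h1, ← Finset.sum_filter,
        ← Finset.sum_image (g := fun i => Fintype.card F ^ i)
          (f := fun j => latticeExpCoeff ϖ j * S (m + 2 - j)) hinj.injOn]
      refine Finset.sum_subset (fun j hj => ?_) fun j hj hj' => ?_
      · obtain ⟨i, hi, rfl⟩ := Finset.mem_image.1 hj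
        exact Finset.mem_range.2 (Finset.mem_filter.1 hi).2
      · rw [hzero j, zero_mul]
        rintro i rfl
        rw [Finset.mem_range] at hj
        refine hj' (Finset.mem_image.2 ⟨i, Finset.mem_filter.2 ⟨?_, hj⟩, rfl⟩)
        exact Finset.mem_range.2 ((Nat.lt_pow_self Fintype.one_lt_card).trans hj)

/-! ### Power series of products of inverse linear forms -/

instance : NonarchimedeanRing (CInf F) where
  is_nonarchimedean := NonarchimedeanAddGroup.is_nonarchimedean

lemma hasSum_of_forall_eq {ι : Type*} {f g : ι → CInf F} {s : CInf F} (hg : HasSum g s)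
    (h : ∀ i, f i = g i) : HasSum f s :=
  (funext h : f = g) ▸ hg

lemma summable_mul_prod {ι κ : Type*} {f : ι → CInf F} {g : κ → CInf F} (hf : Summable f)
    (hg : Summable g) : Summable fun x : ι × κ => f x.1 * g x.2 :=
  hf.mul_of_nonarchimedean hg

/-- A family in `ℂ_∞` dominated by a summable one is summable. -/
lemma summable_of_norm_le {ι : Type*} {f g : ι → CInf F} (hg : Summable g)
    (h : ∀ i, ‖f i‖ ≤ ‖g i‖) : Summable f := by
  apply NonarchimedeanAddGroup.summable_of_tendsto_cofinite_zero
  exact squeeze_zero_norm h (tendsto_zero_iff_norm_tendsto_zero.1 hg.tendsto_cofinite_zero)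

/-- The expansion `∑_i (-a)^i w^{-i-1} X^i` of `1 / (w + a X)`. -/
def invLinSeries (w a : CInf F) : PowerSeries (CInf F) :=
  PowerSeries.mk fun i => (-a) ^ i / w ^ (i + 1)

lemma add_C_mul_X_mul_invLinSeries {w : CInf F} (hw : w ≠ 0) (a : CInf F) :
    (PowerSeries.C a * PowerSeries.X + PowerSeries.C w) * invLinSeries w a = 1 := by
  ext i
  rw [add_mul, map_add, mul_assoc, PowerSeries.coeff_C_mul, PowerSeries.coeff_C_mul]
  rcases i with _ | i
  · simp [invLinSeries, hw]
  · rw [PowerSeries.coeff_succ_X_mul, PowerSeries.coeff_one, if_neg (by omega)]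
    simp only [invLinSeries, PowerSeries.coeff_mk]
    field_simp
    ring

lemma coeff_C_mul_X_add_C_pow (w a : CInf F) (N r : ℕ) :
    PowerSeries.coeff r ((PowerSeries.C a * PowerSeries.X + PowerSeries.C w) ^ N)
      = a ^ r * w ^ (N - r) * N.choose r := by
  have h : ∀ m, (PowerSeries.C a * PowerSeries.X) ^ m * PowerSeries.C w ^ (N - m)
      * (N.choose m : PowerSeries (CInf F))
      = PowerSeries.C (a ^ m * w ^ (N - m) * N.choose m) * PowerSeries.X ^ m := by
    intro m
    simp only [mul_pow, map_mul, map_pow, map_natCast]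
    ring
  rw [add_pow, map_sum]
  simp only [h, PowerSeries.coeff_C_mul, PowerSeries.coeff_X_pow]
  rw [Finset.sum_eq_single r]
  · simp
  · intro m _ hm
    simp [hm.symm]
  · intro hr
    rw [Nat.choose_eq_zero_of_lt (by simpa using hr)]
    simp

/-- The congruence on binomial coefficients makes `(j + c X) ^ (l + n)` constant modulo
`X ^ (n + 1)`, so that up to this constant the `n`-th coefficient of
`1 / ((j + c X) ^ l (w + a X))` is that of `(j + c X) ^ n / (w + a X)`. -/
lemma coeff_invLinSeries_pow_mul {w j : CInf F} (hw : w ≠ 0) (hj : j ≠ 0) (a c : CInf F)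
    {l n : ℕ} (hbinom : ∀ r, 1 ≤ r → r ≤ n → ((l + n).choose r : CInf F) = 0) :
    PowerSeries.coeff n (invLinSeries j c ^ l * invLinSeries w a)
      = (-(a * j - c * w)) ^ n / (j ^ (l + n) * w ^ (n + 1)) := by
  set S := invLinSeries j c ^ l * invLinSeries w a with hS
  set J : PowerSeries (CInf F) := PowerSeries.C c * PowerSeries.X + PowerSeries.C j with hJ
  have h1 : J ^ (l + n) * S = J ^ n * invLinSeries w a := by
    have h : J ^ l * invLinSeries j c ^ l = 1 := by
      rw [← mul_pow, add_C_mul_X_mul_invLinSeries hj, one_pow]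
    rw [hS, pow_add]
    linear_combination (J ^ n * invLinSeries w a) * h
  have h2 : PowerSeries.coeff n (J ^ (l + n) * S) = j ^ (l + n) * PowerSeries.coeff n S := by
    rw [PowerSeries.coeff_mul, Finset.sum_eq_single (0, n)]
    · rw [hJ, coeff_C_mul_X_add_C_pow]; simp
    · rintro ⟨r, s⟩ hrs hne
      rw [Finset.HasAntidiagonal.mem_antidiagonal] at hrs
      simp only at hrs
      have hr : r ≠ 0 := by
        rintro rfl
        exact hne (by rw [← hrs, zero_add])
      rw [hJ, coeff_C_mul_X_add_C_pow, hbinom r (by omega) (by omega)]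
      simp
    · intro h
      exact absurd (Finset.HasAntidiagonal.mem_antidiagonal.2 (zero_add n)) h
  have h3 : PowerSeries.coeff n (J ^ n * invLinSeries w a)
      = (-(a * j - c * w)) ^ n / w ^ (n + 1) := by
    have h : -(a * j - c * w) = c * w + -(a * j) := by ring
    rw [PowerSeries.coeff_mul, Finset.Nat.sum_antidiagonal_eq_sum_range_succ_mk, h,
      add_pow (c * w), Finset.sum_div]
    refine Finset.sum_congr rfl fun r hr => ?_
    have hr' : n + 1 = r + (n - r + 1) := by rw [Finset.mem_range] at hr; omega
    have hw' : w ^ (n + 1) = w ^ r * w ^ (n - r + 1) := by rw [← pow_add, ← hr']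
    rw [hJ, coeff_C_mul_X_add_C_pow, invLinSeries, PowerSeries.coeff_mk, hw', neg_pow a,
      neg_pow (a * j), mul_pow, mul_pow]
    field_simp
  rw [h1, h3] at h2
  rw [← div_div, div_right_comm, h2, mul_div_cancel_left₀ _ (pow_ne_zero _ hj)]

/-- The power series `S` has coefficients bounded by `|S_i| ρ^i ≤ B`, and it sums to the function
`g` on the open disc of radius `ρ`. -/
def HasBoundedExpansion (S : PowerSeries (CInf F)) (ρ B : ℝ) (g : CInf F → CInf F) : Prop :=
  (∀ i, ‖PowerSeries.coeff i S‖ * ρ ^ i ≤ B) ∧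
    ∀ ε, ‖ε‖ < ρ → HasSum (fun i => PowerSeries.coeff i S * ε ^ i) (g ε)

lemma HasBoundedExpansion.mul {S S' : PowerSeries (CInf F)} {ρ B B' : ℝ} {g g' : CInf F → CInf F}
    (hρ : 0 < ρ) (h : HasBoundedExpansion S ρ B g) (h' : HasBoundedExpansion S' ρ B' g') :
    HasBoundedExpansion (S * S') ρ (B * B') (fun ε => g ε * g' ε) := by
  have hB : 0 ≤ B := le_trans (by positivity) (h.1 0)
  have hB' : 0 ≤ B' := le_trans (by positivity) (h'.1 0)
  refine ⟨fun i => ?_, fun ε hε => ?_⟩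
  · rw [← le_div_iff₀ (by positivity), PowerSeries.coeff_mul]
    refine IsUltrametricDist.norm_sum_le_of_forall_le_of_nonneg (by positivity) fun x hx => ?_
    rw [norm_mul, le_div_iff₀ (by positivity), ← Finset.HasAntidiagonal.mem_antidiagonal.1 hx,
      pow_add, mul_mul_mul_comm]
    exact mul_le_mul (h.1 _) (h'.1 _) (by positivity) hB
  · have h1 := (h.2 ε hε).mul_of_nonarchimedean (h'.2 ε hε)
    rw [← Finset.HasAntidiagonal.sigmaAntidiagonalEquivProd.hasSum_iff] at h1
    convert h1.sigma fun i => hasSum_fintype _ using 2 with i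
    rw [PowerSeries.coeff_mul, Finset.sum_mul, ← Finset.sum_coe_sort]
    refine Finset.sum_congr rfl fun x _ => ?_
    have hx : ε ^ i = ε ^ x.1.1 * ε ^ x.1.2 := by
      rw [← pow_add, Finset.HasAntidiagonal.mem_antidiagonal.1 x.2]
    rw [hx]
    exact mul_mul_mul_comm _ _ _ _

lemma HasBoundedExpansion.pow {S : PowerSeries (CInf F)} {ρ B : ℝ} {g : CInf F → CInf F}
    (hρ : 0 < ρ) (h : HasBoundedExpansion S ρ B g) (l : ℕ) :
    HasBoundedExpansion (S ^ l) ρ (B ^ l) (fun ε => g ε ^ l) := by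
  induction l with
  | zero =>
    simp only [pow_zero]
    refine ⟨fun i => ?_, fun ε _ => ?_⟩
    · rcases i with _ | i <;> simp [PowerSeries.coeff_one]
    · convert hasSum_single (f := fun i => PowerSeries.coeff i (1 : PowerSeries (CInf F)) * ε ^ i)
        0 fun i hi => by simp [PowerSeries.coeff_one, hi]
      simp
  | succ l ih =>
    simp only [pow_succ]
    exact ih.mul hρ h

lemma hasBoundedExpansion_invLinSeries {w a : CInf F} {ρ : ℝ} (hρ : 0 < ρ) (hw : w ≠ 0)
    (h : ρ * ‖a‖ ≤ ‖w‖) :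
    HasBoundedExpansion (invLinSeries w a) ρ ‖w‖⁻¹ (fun ε => (w + a * ε)⁻¹) := by
  have hw' : 0 < ‖w‖ := norm_pos_iff.2 hw
  refine ⟨fun i => ?_, fun ε hε => ?_⟩
  · have h1 : ‖PowerSeries.coeff i (invLinSeries w a)‖ * ρ ^ i
        = (ρ * ‖a‖ / ‖w‖) ^ i * ‖w‖⁻¹ := by
      rw [invLinSeries, PowerSeries.coeff_mk, norm_div, norm_pow, norm_pow, norm_neg,
        div_pow, mul_pow, pow_succ]
      field_simp
    rw [h1]
    exact mul_le_of_le_one_left (by positivity)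
      (pow_le_one₀ (by positivity) ((div_le_one hw').2 h))
  · have hlt : ‖-a * ε / w‖ < 1 := by
      rw [norm_div, norm_mul, norm_neg, div_lt_one hw']
      rcases eq_or_ne a 0 with rfl | ha
      · simpa using hw'
      · have := norm_pos_iff.2 ha
        calc ‖a‖ * ‖ε‖ < ‖a‖ * ρ := by gcongr
          _ ≤ ‖w‖ := by rwa [mul_comm]
    have h1 := (hasSum_geometric_of_norm_lt_one hlt).mul_left w⁻¹
    have h2 : w⁻¹ * (1 - -a * ε / w)⁻¹ = (w + a * ε)⁻¹ := by
      rw [← mul_inv]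
      congr 1
      field_simp
      ring
    rw [h2] at h1
    refine hasSum_of_forall_eq h1 fun i => ?_
    simp only [invLinSeries, PowerSeries.coeff_mk, div_pow, mul_pow, pow_succ]
    field_simp

/-! ### Rows of representatives of the cosets -/

/-- The bottom row of the chosen representative of a coset in `H \ Γ`. -/
def bottomRow (q : Cosets F) : F[X] × F[X] := (q.out 1 0, q.out 1 1)

/-- The top rows, indexed by `a : A`, of the matrices of the same determinant in the coset `q`:
the sum of the top row of the representative and of `a` times the bottom row. -/
def topRow (q : Cosets F) (a : F[X]) : F[X] × F[X] :=
  (q.out 0 0 + a * q.out 1 0, q.out 0 1 + a * q.out 1 1)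

/-- The determinant of the chosen representative, as an element of `ℂ_∞`. -/
def cosetDet (q : Cosets F) : CInf F := ofA F (q.out : Matrix (Fin 2) (Fin 2) F[X]).det

lemma topRow_mul_sub (q : Cosets F) (a : F[X]) (z : CInf F) :
    ofA F (topRow q a).1 * linForm (bottomRow q) z - ofA F (bottomRow q).1 * linForm (topRow q a) z
      = cosetDet q := by
  simp only [topRow, bottomRow, cosetDet, linForm, Matrix.det_fin_two, map_sub, map_mul, map_add]
  ring

lemma exists_cosetDet_eq (q : Cosets F) : ∃ e : F, e ≠ 0 ∧ cosetDet q = ofA F (C e) := by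
  obtain ⟨e, he, hC⟩ := Polynomial.isUnit_iff.1
    ((Matrix.isUnit_iff_isUnit_det _).1 q.out.isUnit)
  exact ⟨e, he.ne_zero, by rw [cosetDet, hC]⟩

lemma norm_cosetDet (q : Cosets F) : ‖cosetDet q‖ = 1 := by
  obtain ⟨e, he, h⟩ := exists_cosetDet_eq q
  rw [h, norm_ofA_C he]

lemma cosetDet_pow_mod (q : Cosets F) (N : ℕ) :
    cosetDet q ^ (N % (Fintype.card F - 1)) = cosetDet q ^ N := by
  obtain ⟨e, he, h⟩ := exists_cosetDet_eq q
  have h1 : cosetDet q ^ (Fintype.card F - 1) = 1 := by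
    rw [h, ← map_pow, ← C_pow, FiniteField.pow_card_sub_one_eq_one e he, C_1, map_one]
  conv_rhs => rw [← Nat.mod_add_div N (Fintype.card F - 1)]
  rw [pow_add, pow_mul, h1, one_pow, mul_one]

lemma cosetDet_ne_zero (q : Cosets F) : cosetDet q ≠ 0 := by
  rw [← norm_ne_zero_iff, norm_cosetDet]
  exact one_ne_zero

lemma bottomRow_ne_zero (q : Cosets F) : bottomRow q ≠ 0 := by
  intro h
  apply cosetDet_ne_zero q
  rw [← topRow_mul_sub q 0 0, h]
  simp [linForm]

lemma topRow_ne_zero (q : Cosets F) (a : F[X]) : topRow q a ≠ 0 := by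
  intro h
  apply cosetDet_ne_zero q
  rw [← topRow_mul_sub q a 0, h]
  simp [linForm]

lemma bottomRow_injective {F : Type*} [Field F] : Function.Injective (bottomRow (F := F)) := by
  intro q q' h
  obtain ⟨h0, h1⟩ := Prod.ext_iff.1 h
  simp only [bottomRow] at h0 h1
  rw [← Quotient.out_eq q, ← Quotient.out_eq q']
  refine Quotient.sound (QuotientGroup.rightRel_apply.2 ?_)
  have hrow : ∀ i, (q'.out * q.out⁻¹) 1 i = (q.out * q.out⁻¹) 1 i := by
    intro i
    rw [Matrix.GeneralLinearGroup.coe_mul, Matrix.GeneralLinearGroup.coe_mul, Matrix.mul_apply,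
      Matrix.mul_apply, Fin.sum_univ_two, Fin.sum_univ_two, h0, h1]
  rw [mul_inv_cancel] at hrow
  exact ⟨by simpa using hrow 0, by simpa using hrow 1⟩

lemma rows_injective :
    Function.Injective fun x : Cosets F × F[X] => (bottomRow x.1, topRow x.1 x.2) := by
  rintro ⟨q, a⟩ ⟨q', a'⟩ h
  obtain ⟨h1, h2⟩ := Prod.ext_iff.1 h
  obtain rfl : q = q' := bottomRow_injective h1
  simp only [topRow, Prod.mk.injEq, add_right_inj, mul_eq_mul_right_iff] at h2
  have h3 := bottomRow_ne_zero q
  rw [Prod.mk.injEq]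
  refine ⟨rfl, ?_⟩
  by_contra hne
  exact h3 (Prod.ext (h2.1.resolve_left hne) (h2.2.resolve_left hne))

/-! ### The double series behind a Poincaré series -/

/-- The term of index `(q, a)` in the double series of `P_{l+N,N}`, where `j` and `w` are the
linear forms of the bottom and top row: `ϖ⁻ᴺ det^N / (j^l w^N)`. -/
def doubleTerm (ϖ : CInf F) (l N : ℕ) (z : CInf F) (x : Cosets F × F[X]) : CInf F :=
  (ϖ ^ N)⁻¹ * cosetDet x.1 ^ N
    * ((linForm (bottomRow x.1) z ^ l)⁻¹ * (linForm (topRow x.1 x.2) z ^ N)⁻¹)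

lemma hasSum_doubleTerm {ϖ : CInf F} (hϖ : ϖ ≠ 0) (l : ℕ) {N : ℕ} (hN : N ≠ 0) (z : Omega F)
    (q : Cosets F) :
    HasSum (fun a => doubleTerm ϖ l N z (q, a)) (poincareTerm ϖ (l + N) N z q) := by
  have h1 : poincareTerm ϖ (l + N) N z q = slash (l + N) (N % (Fintype.card F - 1))
      (fun w => (gossPoly ϖ N).eval (unif ϖ w)) q.out z := by
    conv_lhs => rw [← Quotient.out_eq q]
    rfl
  have hj : jfac q.out (z : CInf F) ≠ 0 := jfac_ne_zero q.out z.2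
  rw [h1, slash, gossPoly_eval_unif hϖ _ hN]
  change HasSum _ (cosetDet q ^ (N % (Fintype.card F - 1)) / _ * _)
  rw [cosetDet_pow_mod]
  have h2 := ((summable_inv_add_ofA_pow (moebius q.out z).2 hN).hasSum.mul_left (ϖ ^ N)⁻¹).mul_left
    (cosetDet q ^ N / jfac q.out z ^ (l + N))
  refine hasSum_of_forall_eq h2 fun a => ?_
  have hw : linForm (topRow q a) (z : CInf F)
      = jfac q.out z * ((moebius q.out z : Omega F) + ofA F a) := by
    simp only [moebius, mul_add, mul_div_cancel₀ _ hj]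
    simp only [linForm, topRow, jfac, map_add, map_mul]
    ring
  have hne : ((moebius q.out z : Omega F) : CInf F) + ofA F a ≠ 0 := by
    have h := linForm_ne_zero (topRow_ne_zero q a) z.2
    rw [hw] at h
    exact right_ne_zero_of_mul h
  rw [doubleTerm, hw, mul_pow, pow_add]
  change _ * ((jfac q.out (z : CInf F) ^ l)⁻¹ * _) = _
  field_simp

lemma summable_inv_rows (z : Omega F) {l N : ℕ} (hl : l ≠ 0) (hN : N ≠ 0) :
    Summable fun x : Cosets F × F[X] =>
      (linForm (bottomRow x.1) (z : CInf F) ^ l)⁻¹ * (linForm (topRow x.1 x.2) (z : CInf F) ^ N)⁻¹ := by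
  have hf := summable_inv_linForm_pow z.2 hl
  have hg := summable_inv_linForm_pow z.2 hN
  have h := summable_mul_prod hf hg
  have h' := h.comp_injective (rows_injective (F := F))
  exact h'

lemma summable_doubleTerm (ϖ : CInf F) (z : Omega F) {l N : ℕ} (hl : l ≠ 0) (hN : N ≠ 0) :
    Summable (doubleTerm ϖ l N (z : CInf F)) := by
  refine summable_of_norm_le ((summable_inv_rows z hl hN).mul_left (ϖ ^ N)⁻¹) fun x => le_of_eq ?_
  rw [doubleTerm, norm_mul, norm_mul, norm_pow, norm_cosetDet, one_pow, mul_one, ← norm_mul]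

/-- For positive `l` and `N` the Poincaré series `P_{l+N,N}` converges, and its sum is that of the
double series. -/
lemma hasSum_poincareTerm {ϖ : CInf F} (hϖ : ϖ ≠ 0) (z : Omega F) {l N : ℕ} (hl : l ≠ 0)
    (hN : N ≠ 0) :
    HasSum (poincareTerm ϖ (l + N) N z) (∑' x, doubleTerm ϖ l N (z : CInf F) x) :=
  (summable_doubleTerm ϖ z hl hN).hasSum.prod_fiberwise fun q => hasSum_doubleTerm hϖ l hN z q

lemma tsum_doubleTerm {ϖ : CInf F} (hϖ : ϖ ≠ 0) (z : Omega F) {l N : ℕ} (hl : l ≠ 0)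
    (hN : N ≠ 0) : ∑' x, doubleTerm ϖ l N (z : CInf F) x = poincare ϖ (l + N) N z :=
  (hasSum_poincareTerm hϖ z hl hN).tsum_eq.symm

/-! ### The expansion of `P_{k,1}` -/

lemma isOpen_Omega : IsOpen (Omega F) :=
  ((algebraMap_isometry (KInf F) (CInf F)).isClosedEmbedding).isClosed_range.isOpen_compl

/-- The expansion of `ε ↦ doubleTerm ϖ l 1 (z + ε) x`. -/
def termSeries (ϖ : CInf F) (l : ℕ) (z : CInf F) (x : Cosets F × F[X]) : PowerSeries (CInf F) :=
  PowerSeries.C (ϖ⁻¹ * cosetDet x.1) *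
    (invLinSeries (linForm (bottomRow x.1) z) (ofA F (bottomRow x.1).1) ^ l
      * invLinSeries (linForm (topRow x.1 x.2) z) (ofA F (topRow x.1 x.2).1))

/-- `P_{l+1,1}` expands around `z` with the coefficients obtained by expanding its double series
term by term: on a small disc the triple series converges, so that it may be rearranged. -/
lemma hasHyperExpansion_poincare {ϖ : CInf F} (hϖ : ϖ ≠ 0) {l : ℕ} (hl : l ≠ 0) (z : Omega F) :
    HasHyperExpansion (poincare ϖ (l + 1) 1) z
      (fun i => ∑' x, PowerSeries.coeff i (termSeries ϖ l z x)) := by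
  obtain ⟨ρ, hρ, hrow⟩ := exists_norm_linForm_ge z.2
  -- a radius of the form `|π|` makes the bounds below absolute values of elements of `ℂ_∞`
  obtain ⟨π, hπ0, hπρ⟩ := NormedField.exists_norm_lt (CInf F) hρ
  have hπ : π ≠ 0 := norm_pos_iff.1 hπ0
  obtain ⟨r, hr0, hr⟩ := Metric.isOpen_iff.1 (isOpen_Omega (F := F)) z z.2
  set j : Cosets F × F[X] → CInf F := fun x => linForm (bottomRow x.1) z with hj
  set w : Cosets F × F[X] → CInf F := fun x => linForm (topRow x.1 x.2) z with hw
  have hrow' : ∀ y : F[X] × F[X], ‖π‖ * ‖ofA F y.1‖ ≤ ‖linForm y (z : CInf F)‖ := fun y =>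
    (mul_le_mul_of_nonneg_right hπρ.le (norm_nonneg _)).trans (hrow y).1
  have hexp : ∀ x, HasBoundedExpansion
      (invLinSeries (j x) (ofA F (bottomRow x.1).1) ^ l
        * invLinSeries (w x) (ofA F (topRow x.1 x.2).1)) ‖π‖ (‖j x‖⁻¹ ^ l * ‖w x‖⁻¹)
      (fun ε => (j x + ofA F (bottomRow x.1).1 * ε)⁻¹ ^ l
        * (w x + ofA F (topRow x.1 x.2).1 * ε)⁻¹) := fun x =>
    ((hasBoundedExpansion_invLinSeries hπ0 (linForm_ne_zero (bottomRow_ne_zero _) z.2)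
      (hrow' _)).pow hπ0 l).mul hπ0
      (hasBoundedExpansion_invLinSeries hπ0 (linForm_ne_zero (topRow_ne_zero _ _) z.2) (hrow' _))
  set b : Cosets F × F[X] → CInf F := fun x => ϖ⁻¹ * ((j x ^ l)⁻¹ * (w x ^ 1)⁻¹) with hb
  have hbsum : Summable b := (summable_inv_rows z hl one_ne_zero).mul_left ϖ⁻¹
  have hcoeff : ∀ x i, ‖PowerSeries.coeff i (termSeries ϖ l z x)‖ ≤ ‖b x‖ * (‖π‖ ^ i)⁻¹ := by
    intro x i
    rw [le_mul_inv_iff₀ (by positivity), termSeries, PowerSeries.coeff_C_mul, norm_mul, norm_mul,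
      norm_cosetDet, mul_one, mul_assoc, hb, norm_mul]
    refine mul_le_mul_of_nonneg_left (((hexp x).1 i).trans (le_of_eq ?_)) (norm_nonneg _)
    rw [norm_mul, norm_inv, norm_inv, norm_pow, norm_pow, pow_one, inv_pow]
  refine ⟨min r ‖π‖, lt_min hr0 hπ0, fun ε hε => ?_⟩
  have hεr : ‖ε‖ < r := hε.trans_le (min_le_left _ _)
  have hεπ : ‖ε‖ < ‖π‖ := hε.trans_le (min_le_right _ _)
  have hmem : (z : CInf F) + ε ∈ Omega F := hr (by simpa [dist_eq_norm] using hεr)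
  refine ⟨hmem, ?_⟩
  have hgeo : Summable fun i : ℕ => (ε / π) ^ i := by
    refine (hasSum_geometric_of_norm_lt_one ?_).summable
    rwa [norm_div, div_lt_one hπ0]
  have htriple : Summable fun y : (Cosets F × F[X]) × ℕ =>
      PowerSeries.coeff y.2 (termSeries ϖ l z y.1) * ε ^ y.2 := by
    refine summable_of_norm_le (summable_mul_prod hbsum hgeo) fun y => ?_
    rw [norm_mul, norm_mul, norm_pow, norm_pow, norm_div, div_pow, div_eq_inv_mul, ← mul_assoc]
    exact mul_le_mul_of_nonneg_right (hcoeff y.1 y.2) (by positivity)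
  have hcol : ∀ i, Summable fun x => PowerSeries.coeff i (termSeries ϖ l z x) := by
    intro i
    refine summable_of_norm_le (hbsum.mul_right (π ^ i)⁻¹) fun x => ?_
    rw [norm_mul, norm_inv, norm_pow]
    exact hcoeff x i
  have hterm : ∀ x, HasSum (fun i => PowerSeries.coeff i (termSeries ϖ l z x) * ε ^ i)
      (doubleTerm ϖ l 1 (z + ε) x) := by
    intro x
    have h := ((hexp x).2 ε hεπ).mul_left (ϖ⁻¹ * cosetDet x.1)
    have hlin : ∀ y : F[X] × F[X],
        linForm y ((z : CInf F) + ε) = linForm y (z : CInf F) + ofA F y.1 * ε := by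
      intro y
      simp only [linForm]
      ring
    rw [doubleTerm, hlin, hlin, pow_one, pow_one, pow_one, ← inv_pow]
    refine hasSum_of_forall_eq h fun i => ?_
    simp only [termSeries, PowerSeries.coeff_C_mul, mul_assoc]
    rfl
  have h1 := htriple.hasSum.prod_fiberwise hterm
  have h2 := ((Equiv.prodComm ℕ (Cosets F × F[X])).hasSum_iff.2 htriple.hasSum).prod_fiberwise
    fun i => (hcol i).hasSum.mul_right (ε ^ i)
  rw [← tsum_doubleTerm hϖ ⟨z + ε, hmem⟩ hl one_ne_zero, h1.tsum_eq]
  exact h2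

lemma HasHyperExpansion.unique {f : Omega F → CInf F} {z : Omega F} {c c' : ℕ → CInf F}
    (h : HasHyperExpansion f z c) (h' : HasHyperExpansion f z c') : c = c' := by
  classical
  let g : CInf F → CInf F := fun x => if hx : x ∈ Omega F then f ⟨x, hx⟩ else 0
  have key : ∀ {c : ℕ → CInf F}, HasHyperExpansion f z c →
      HasFPowerSeriesAt g (FormalMultilinearSeries.ofScalars (CInf F) c) z := by
    rintro c ⟨r, hr0, hr⟩
    rw [hasFPowerSeriesAt_iff]
    filter_upwards [Metric.ball_mem_nhds (0 : CInf F) hr0] with ε hε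
    obtain ⟨hmem, hsum⟩ := hr ε (by simpa using hε)
    simp only [g, dif_pos hmem, smul_eq_mul, FormalMultilinearSeries.coeff_ofScalars]
    simpa only [mul_comm] using hsum
  have h1 := (key h).eq_formalMultilinearSeries (key h')
  funext n
  have h2 := congrArg (fun s => s.coeff n) h1
  simpa only [FormalMultilinearSeries.coeff_ofScalars] using h2

lemma HasHyperExpansion.unalteredHyperderiv_eq {f : Omega F → CInf F} {z : Omega F}
    {c : ℕ → CInf F} (h : HasHyperExpansion f z c) (n : ℕ) : unalteredHyperderiv n f z = c n := by
  have hex : ∃ c, HasHyperExpansion f z c := ⟨c, h⟩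
  rw [unalteredHyperderiv, dif_pos hex, hex.choose_spec.unique h]

/-- Term by term, the `n`-th coefficient of the double series of `P_{l+1,1}` is a multiple of the
double series of `P_{l+1+2n,1+n}`. -/
lemma coeff_termSeries {ϖ : CInf F} (hϖ : ϖ ≠ 0) {l n : ℕ}
    (hbinom : ∀ r, 1 ≤ r → r ≤ n → ((l + n).choose r : CInf F) = 0) (z : Omega F)
    (x : Cosets F × F[X]) :
    PowerSeries.coeff n (termSeries ϖ l z x)
      = (-1) ^ n * ϖ ^ n * doubleTerm ϖ (l + n) (1 + n) z x := by
  rw [termSeries, PowerSeries.coeff_C_mul, coeff_invLinSeries_pow_mul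
    (linForm_ne_zero (topRow_ne_zero _ _) z.2) (linForm_ne_zero (bottomRow_ne_zero _) z.2) _ _
    hbinom, topRow_mul_sub, doubleTerm, neg_pow, add_comm 1 n, pow_succ ϖ, pow_succ (cosetDet x.1)]
  field_simp

end Drinfeld

end

theorem mainTheorem3 {F : Type*} [Field F] [Fintype F] {p : ℕ} [Fact p.Prime] [CharP F p]
    {ϖ : Drinfeld.CInf F} (hϖ : Drinfeld.IsCarlitzPeriod ϖ) {k n : ℕ} (hk : 0 < k) (hn : 0 < n)
    (hbinom : ∀ j, 1 ≤ j → j ≤ n → (k + n - 1).choose j ≡ 0 [MOD p]) :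
    (∀ z : Drinfeld.Omega F, Summable (Drinfeld.poincareTerm ϖ k 1 z)) ∧
    (∀ z : Drinfeld.Omega F, Summable (Drinfeld.poincareTerm ϖ (k + 2 * n) (1 + n) z)) ∧
    (∀ z : Drinfeld.Omega F, ∃ c, Drinfeld.HasHyperExpansion (Drinfeld.poincare ϖ k 1) z c) ∧
    Drinfeld.hyperderiv ϖ n (Drinfeld.poincare ϖ k 1) = Drinfeld.poincare ϖ (k + 2 * n) (1 + n) := by
  open Drinfeld in
  obtain ⟨l, rfl⟩ : ∃ l, k = l + 1 := ⟨k - 1, by omega⟩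
  have hϖ0 : ϖ ≠ 0 := hϖ.1
  -- for `k = 1` the hypothesis would give `binom(n, n) = 0` in characteristic `p`
  have hl : l ≠ 0 := by
    rintro rfl
    have h := hbinom n hn le_rfl
    rw [show 0 + 1 + n - 1 = n by omega, Nat.choose_self, Nat.modEq_zero_iff_dvd] at h
    exact (Fact.out : p.Prime).one_lt.ne' (Nat.dvd_one.1 h)
  have hchoose : ∀ r, 1 ≤ r → r ≤ n → ((l + n).choose r : CInf F) = 0 := by
    intro r h1 h2
    have h := hbinom r h1 h2
    rw [show l + 1 + n - 1 = l + n by omega, Nat.modEq_zero_iff_dvd,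
      ← CharP.cast_eq_zero_iff F p] at h
    simpa using congrArg ((ofA F).comp Polynomial.C) h
  have hweight : l + 1 + 2 * n = l + n + (1 + n) := by ring
  rw [hweight]
  refine ⟨fun z => (hasSum_poincareTerm hϖ0 z hl one_ne_zero).summable,
    fun z => (hasSum_poincareTerm hϖ0 z (by omega) (by omega)).summable,
    fun z => ⟨_, hasHyperExpansion_poincare hϖ0 hl z⟩, ?_⟩
  funext z
  rw [hyperderiv, (hasHyperExpansion_poincare hϖ0 hl z).unalteredHyperderiv_eq,
    ← tsum_doubleTerm hϖ0 z (by omega) (by omega)]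
  simp only [coeff_termSeries hϖ0 hchoose]
  rw [tsum_mul_left, ← mul_assoc, div_mul_eq_mul_div, ← mul_assoc, ← mul_pow, neg_one_mul, neg_neg,
    one_pow, one_mul, div_self (pow_ne_zero _ hϖ0), one_mul]
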